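/- **Setting.** A *weighted timed automaton* $\mathcal A=(X,L,\ell_0,\mathrm{Goal},E,w)$ has a finite set $X$ of clocks, a finite set $L$ of locations, an initial location $\ell_0$, goal locations, a finite set $E$ of edges $(\ell,g,r,\ell')$, where $r\subseteq X$ is the set of clocks that are reset and the guard $g$ is a conjunction of constraints $x\sim c$ with $c\in\mathbb N$ and $\sim\ \in\{<,\le,=,\ge,>\}$, and weights $w:L\cup E\to\mathbb Z$ (cost rates of locations, costs of edges). Valuations are the elements of $\mathbb R_{\ge0}^X$. Fix $M:X\to\mathbb N\cup\{-\infty\}$ such that $M(x)\ge c$ whenever $x$ is compared with $c$ in a guard. **Priced zones and forward exploration.** A *zone* is a set of valuations defined by finitely many constraints $x\sim c$, $x-y\sim c$ with $c\in\mathbb Z$. A *priced zone* is a pair $\mathcal Z=(Z,\zeta)$ of a zone and an affine function $\zeta(v)=\sum_x\zeta_xv(x)+c_0$. A *lower* (*upper*) *facet* of $Z$ is a set $F=\overline Z\cap(f=n)$ where $n\in\mathbb Z$ and $f\ge n$ ($f\le n$) is a tight constraint on $\overline Z$; it is a facet with respect to $y$ if $f=y$ or $f=y-x$ with $x\neq y$.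 Write $Z^\uparrow=\{v+t: v\in Z,\ t\ge 0\}$. * *Delay* at rate $w(\ell)$: if $w(\ell)\ge\sum_x\zeta_x$, the results are $\mathcal Z$ and the priced zones $(Z^\uparrow\cap F^\uparrow,\zeta^F)$ for the upper facets $F=\overline Z\cap(x=n)$, $x\in X$; otherwise they are the priced zones $(Z^\uparrow\cap F^\uparrow,\zeta^F)$ for the lower facets $F=\overline Z\cap(x=n)$, $x\in X$. Here $\zeta^F(v)=\zeta(v-t)+t\,w(\ell)$ with $t=v(x)-n$. * *Reset* of a clock $y$: the results are indexed by the lower facets $F$ with respect to $y$ if $\zeta_y\ge0$, and by the upper ones if $\zeta_y<0$. The result for $F$ has as its zone the image under $y:=0$ of the valuations of $Z$ that agree outside $y$ with a point of $F$, and as its cost the function $\zeta$ in which $n$ (if $F$ is given by $y=n$) or $x+n$ (if $F$ is given by $y-x=n$) is substituted for $y$. * *Edge* $e=(\ell,g,r,\ell')$: intersect the zone with $g$, reset the clocks of $r$ one after the other in some order, and add $w(e)$ to the cost. $\mathrm{Post}(\ell,\mathcal Z)$ is the set of results of a delay at rate $w(\ell)$ followed by an edge leaving $\ell$. The *symbolic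 states computed during the forward exploration* are those obtained from $(\ell_0,(\{\mathbf 0\},0))$ by iterating $\mathrm{Post}$, and the intermediate ones obtained from these by a delay. **Corner-point abstraction.** Let $\mathcal R$ be the set of regions (classes of the usual region equivalence with respect to $M$). For $R\in\mathcal R$ let $Y_R$ be the set of clocks $x$ with $x\le M(x)$ on $R$. A *corner* of $R$ is a point of $\mathbb N^{Y_R}$ in the closure of the projection $\pi_{Y_R}(R)$. The weighted graph $\mathcal A_{\mathsf{cp}}$ has as its states the triples $(\ell,(R,\alpha))$ with $\ell\in L$, $R\in\mathcal R$ and $\alpha$ a corner of $R$; its initial state is given by $\ell_0$, the region of $\mathbf 0$ and the corner $0$. Its transitions are: 1. (delay) $(\ell,(R,\alpha))\to(\ell,(R,\alpha'))$ of weight $w(\ell)$, if $\alpha'=\alpha+1$ and $\alpha\ne\alpha'$ are corners of $R$; 2. (delay) $(\ell,(R,\alpha))\to(\ell,(R,\alpha))$ of weight $w(\ell)$, if $Y_R=\emptyset$; 3. (delay) $(\ell,(R,\alpha))\to(\ell,(R',\alpha'))$ of weight $0$, if $R'$ is the immediate time successor of $R$ and $\alpha'=\pi_{Y_{R'}}(\alpha)$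 is a corner of $R'$; 4. (discrete) $(\ell,(R,\alpha))\to(\ell',(R',\alpha'))$ of weight $w(e)$, for $e=(\ell,g,r,\ell')\in E$ with $R\subseteq g$, where $R'$ is the region containing $[r\leftarrow0]R$ and $\alpha'$ is the corner of $R'$ that is $0$ on the clocks of $r$ and equals $\alpha$ on the other clocks of $Y_{R'}$. **Proposition.** Let $(\ell,\mathcal Z_i)_{i\ge0}$, with $\mathcal Z_i=(Z_i,\zeta_i)$, be an infinite sequence of symbolic states computed during the forward exploration of $\mathcal A$, such that every $\zeta_i$ is bounded from below on $Z_i$. For $Y\subseteq X$ write $(Z_i)_Y=\{v\in Z_i : \{x : v(x)\le M(x)\}=Y\}$. Suppose that for some $Y\subseteq X$ we have $\pi_Y((Z_{i+1})_Y)\subseteq\pi_Y((Z_i)_Y)$ for all $i$, and that the tuples $$\kappa_i=\Bigl(\min\{\zeta_i(v) : v\in\overline{(Z_i)_Y},\ \pi_Y(v)=u\}\Bigr)_{u\in\mathbb N^Y\cap\prod_{y\in Y}[0,M(y)]}$$ (with $\min\emptyset=+\infty$) form an infinite antichain, that is, $\kappa_i\not\le\kappa_j$ pointwise for all $i\ne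 j$. Then $\mathcal A_{\mathsf{cp}}$ has a cycle that is reachable from its initial state, has negative total weight, and does not consist only of delay transitions. -/

import Mathlib

open scoped NNReal

noncomputable section

namespace PTA

/-! ### Clock valuations, guards, weighted timed automata -/

/-- Clock valuations over the clocks `X`. -/
abbrev Valuation (X : Type*) := X → ℝ≥0

/-- The valuation `v + t`. -/
def Valuation.delay {X : Type*} (v : Valuation X) (t : ℝ≥0) : Valuation X := fun x => v x + t

/-- The valuation `[Y ← 0] v`. -/
def Valuation.reset {X : Type*} [DecidableEq X] (Y : Finset X) (v : Valuation X) : Valuation X :=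
  fun x => if x ∈ Y then 0 else v x

/-- The comparison symbols `<, ≤, =, ≥, >`. -/
inductive Cmp
  | lt | le | eq | ge | gt

/-- `a ∼ b` -/
def Cmp.Holds : Cmp → ℝ → ℝ → Prop
  | .lt, a, b => a < b
  | .le, a, b => a ≤ b
  | .eq, a, b => a = b
  | .ge, a, b => b ≤ a
  | .gt, a, b => b < a

/-- An atomic clock constraint `x ∼ c`, `c ∈ ℕ`. -/
structure ClockAtom (X : Type*) where
  clock : X
  rel : Cmp
  const : ℕ

/-- Clock constraints: finite conjunctions of atomic ones. -/
abbrev Guard (X : Type*) := List (ClockAtom X)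

/-- `v ⊨ g` -/
def Guard.Sat {X : Type*} (g : Guard X) (v : Valuation X) : Prop :=
  ∀ a ∈ g, a.rel.Holds (v a.clock) a.const

/-- Edges `(ℓ, g, Y, ℓ')`. -/
structure Edge (X L : Type*) where
  src : L
  guard : Guard X
  reset : Finset X
  tgt : L

/-- Weighted timed automata with clocks `X` and locations `L`; only the values of `edgeWeight` on
`edges` matter. -/
structure WTA (X L : Type*) where
  init : L
  goal : Set L
  edges : Set (Edge X L)
  edges_finite : edges.Finite
  locWeight : L → ℤ
  edgeWeight : Edge X L → ℤ

/-- `M` is at least every constant to which a clock is compared; `M x = ⊥` stands for `-∞`. -/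
def IsMaxConst {X L : Type*} (A : WTA X L) (M : X → WithBot ℕ) : Prop :=
  ∀ e ∈ A.edges, ∀ a ∈ e.guard, (a.const : WithBot ℕ) ≤ M a.clock

/-! ### Priced zones -/

/-- Atomic constraints `x ∼ c` and `x - y ∼ c`, `c ∈ ℤ`, defining zones. -/
inductive ZoneAtom (X : Type*)
  | clock (x : X) (r : Cmp) (c : ℤ)
  | diff (x y : X) (r : Cmp) (c : ℤ)

/-- Satisfaction of an atomic zone constraint. -/
def ZoneAtom.Sat {X : Type*} : ZoneAtom X → Valuation X → Prop
  | .clock x r c, v => r.Holds (v x) c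
  | .diff x y r c, v => r.Holds ((v x : ℝ) - v y) c

/-- Zones. -/
def IsZone {X : Type*} (Z : Set (Valuation X)) : Prop :=
  ∃ l : List (ZoneAtom X), Z = {v | ∀ a ∈ l, a.Sat v}

/-- Affine functions, given by their coefficients and their constant term. -/
structure CostFun (X : Type*) where
  coef : X → ℝ
  const : ℝ

namespace CostFun

variable {X : Type*} [Fintype X]

/-- The value of an affine function at a valuation. -/
def eval (ζ : CostFun X) (v : Valuation X) : ℝ := ∑ x, ζ.coef x * v x + ζ.const

/-- The derivative of an affine function in the direction of time elapse. -/
def slope (ζ : CostFun X) : ℝ := ∑ x, ζ.coef x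

/-- `ζ + w` -/
def addConst (ζ : CostFun X) (w : ℝ) : CostFun X := ⟨ζ.coef, ζ.const + w⟩

/-- The function `v ↦ ζ (v - t) + t * w` with `t = v x - n`: the cost after having waited at rate
`w` since the valuation was on the hyperplane `x = n`. -/
def afterDelay [DecidableEq X] (ζ : CostFun X) (w : ℝ) (x : X) (n : ℤ) : CostFun X :=
  ⟨Function.update ζ.coef x (ζ.coef x + (w - ζ.slope)), ζ.const - n * (w - ζ.slope)⟩

/-- The function obtained from `ζ` by substituting `n` for `y`. -/
def substConst [DecidableEq X] (ζ : CostFun X) (y : X) (n : ℤ) : CostFun X :=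
  ⟨Function.update ζ.coef y 0, ζ.const + ζ.coef y * n⟩

/-- The function obtained from `ζ` by substituting `x + m` for `y` (where `x ≠ y`). -/
def substClock [DecidableEq X] (ζ : CostFun X) (y x : X) (m : ℤ) : CostFun X :=
  ⟨Function.update (Function.update ζ.coef x (ζ.coef x + ζ.coef y)) y 0, ζ.const + ζ.coef y * m⟩

end CostFun

/-- Priced zones `(Z, ζ)`. -/
structure PricedZone (X : Type*) where
  zone : Set (Valuation X)
  isZone : IsZone zone
  cost : CostFun X

/-- The cost function is bounded from below on the zone. -/
def PricedZone.LowerBounded {X : Type*} [Fintype X] (P : PricedZone X) : Prop :=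
  BddBelow (P.cost.eval '' P.zone)

theorem isZone_zero {X : Type*} [Fintype X] : IsZone ({fun _ => 0} : Set (Valuation X)) := by
  refine ⟨Finset.univ.toList.map fun x => ZoneAtom.clock x Cmp.eq 0, ?_⟩
  ext v
  simp [ZoneAtom.Sat, Cmp.Holds, funext_iff]

/-- The initial priced zone: all clocks are `0` and the cost is identically `0`. -/
def PricedZone.initial (X : Type*) [Fintype X] : PricedZone X :=
  ⟨{fun _ => 0}, isZone_zero, ⟨fun _ => 0, 0⟩⟩

/-! ### The successor operation on priced zones

Facets of a zone `Z` are the sets `closure Z ∩ (f = n)` for a tight lower bound `n ≤ f` or a tight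
upper bound `f ≤ n`, where `f` is a clock or a difference of two clocks. -/

/-- `n ≤ f` is a tight constraint on `W`. -/
def TightLower {X : Type*} (W : Set (Valuation X)) (f : Valuation X → ℝ) (n : ℤ) : Prop :=
  (∀ v ∈ W, (n : ℝ) ≤ f v) ∧ ∃ v ∈ W, f v = n

/-- `f ≤ n` is a tight constraint on `W`. -/
def TightUpper {X : Type*} (W : Set (Valuation X)) (f : Valuation X → ℝ) (n : ℤ) : Prop :=
  (∀ v ∈ W, f v ≤ (n : ℝ)) ∧ ∃ v ∈ W, f v = n

/-- `closure Z ∩ (f = n)` -/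
def facet {X : Type*} (Z : Set (Valuation X)) (f : Valuation X → ℝ) (n : ℤ) :
    Set (Valuation X) := {v ∈ closure Z | f v = n}

/-- The time successors of a set of valuations. -/
def future {X : Type*} (Z : Set (Valuation X)) : Set (Valuation X) :=
  {v | ∃ u ∈ Z, ∃ t : ℝ≥0, v = u.delay t}

/-- The image under `y := 0` of the part of `Z` that lies above or below `F` in the direction of
the `y`-axis. -/
def resetAlong {X : Type*} [DecidableEq X] (Z F : Set (Valuation X)) (y : X) :
    Set (Valuation X) :=
  {v' | ∃ v ∈ Z, (∃ u ∈ F, ∀ x, x ≠ y → u x = v x) ∧ v' = v.reset {y}}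

section Post

variable {X L : Type*} [Fintype X] [DecidableEq X]

/-- `DelayPost w P P'`: `P'` is one of the priced zones into which the time successors of `P` at
rate `w` are decomposed. If `w` is at least the slope of the cost in the direction of time, waiting
should start as late as possible: the pieces are `P` and the futures of the upper facets.
Otherwise waiting should start as early as possible: the pieces are the futures of the lower
facets. For a closed zone, `future Z ∩ future F = future F`. -/
inductive DelayPost (w : ℤ) (P P' : PricedZone X) : Prop
  | stay (hw : P.cost.slope ≤ w) (h : P' = P)
  | upper (x : X) (n : ℤ) (hw : P.cost.slope ≤ w)
      (ht : TightUpper (closure P.zone) (fun v => v x) n)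
      (hz : P'.zone = future P.zone ∩ future (facet P.zone (fun v => v x) n))
      (hc : P'.cost = P.cost.afterDelay w x n)
  | lower (x : X) (n : ℤ) (hw : w < P.cost.slope)
      (ht : TightLower (closure P.zone) (fun v => v x) n)
      (hz : P'.zone = future P.zone ∩ future (facet P.zone (fun v => v x) n))
      (hc : P'.cost = P.cost.afterDelay w x n)

/-- `ResetPost y P P'`: `P'` is one of the priced zones into which the result of resetting the
single clock `y` in `P` is decomposed. The infimum of the cost over all values of `y` is taken on
the lower facets with respect to `y` if the coefficient of `y` is nonnegative, and on the upper
facets otherwise. -/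
inductive ResetPost (y : X) (P P' : PricedZone X) : Prop
  | lowerClock (n : ℤ) (hy : 0 ≤ P.cost.coef y)
      (ht : TightLower (closure P.zone) (fun v => v y) n)
      (hz : P'.zone = resetAlong P.zone (facet P.zone (fun v => v y) n) y)
      (hc : P'.cost = P.cost.substConst y n)
  | lowerDiff (x : X) (m : ℤ) (hx : x ≠ y) (hy : 0 ≤ P.cost.coef y)
      (ht : TightLower (closure P.zone) (fun v => (v y : ℝ) - v x) m)
      (hz : P'.zone = resetAlong P.zone (facet P.zone (fun v => (v y : ℝ) - v x) m) y)
      (hc : P'.cost = P.cost.substClock y x m)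
  | upperClock (n : ℤ) (hy : P.cost.coef y < 0)
      (ht : TightUpper (closure P.zone) (fun v => v y) n)
      (hz : P'.zone = resetAlong P.zone (facet P.zone (fun v => v y) n) y)
      (hc : P'.cost = P.cost.substConst y n)
  | upperDiff (x : X) (m : ℤ) (hx : x ≠ y) (hy : P.cost.coef y < 0)
      (ht : TightUpper (closure P.zone) (fun v => (v y : ℝ) - v x) m)
      (hz : P'.zone = resetAlong P.zone (facet P.zone (fun v => (v y : ℝ) - v x) m) y)
      (hc : P'.cost = P.cost.substClock y x m)

/-- Successive resets of the clocks of a list. -/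
def ResetListPost : List X → PricedZone X → PricedZone X → Prop
  | [], P, P' => P' = P
  | y :: l, P, P' => ∃ Q, ResetPost y P Q ∧ ResetListPost l Q P'

/-- The discrete successors of a priced zone along an edge `e` of weight `w`: intersection with the
guard, reset of the clocks of `e` one after the other (in any order), addition of `w`. -/
def EdgePost (e : Edge X L) (w : ℤ) (P P' : PricedZone X) : Prop :=
  ∃ (Q R : PricedZone X) (l : List X),
    Q.zone = {v ∈ P.zone | e.guard.Sat v} ∧ Q.cost = P.cost ∧
    l.Nodup ∧ l.toFinset = e.reset ∧ ResetListPost l Q R ∧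
    P'.zone = R.zone ∧ P'.cost = R.cost.addConst w

/-- The operation `Post` on symbolic states `(ℓ, P)`: a delay followed by an edge. -/
def Post (A : WTA X L) (s s' : L × PricedZone X) : Prop :=
  ∃ e ∈ A.edges, e.src = s.1 ∧ e.tgt = s'.1 ∧
    ∃ Q, DelayPost (A.locWeight s.1) s.2 Q ∧ EdgePost e (A.edgeWeight e) Q s'.2

/-- The symbolic states computed during the forward exploration: the iterated `Post`-successors of
the initial symbolic state, and the intermediate states obtained from these by delay. -/
def Explored (A : WTA X L) (s : L × PricedZone X) : Prop :=
  ∃ s₀, Relation.ReflTransGen (Post A) (A.init, PricedZone.initial X) s₀ ∧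
    (s = s₀ ∨ (s.1 = s₀.1 ∧ DelayPost (A.locWeight s₀.1) s₀.2 s.2))

end Post

/-! ### The tuples of minima -/

/-- `a ≤ m`, for `m ∈ ℕ ∪ {-∞}`. -/
def LeBound (m : WithBot ℕ) (a : ℝ≥0) : Prop := ∃ k : ℕ, m = k ∧ a ≤ k

/-- The projection `π_Y`. -/
def proj {X : Type*} (Y : Set X) (v : Valuation X) : Valuation Y := fun y => v y

/-- `Z_Y`: the part of `Z` where exactly the clocks of `Y` are at most their bound `M`. -/
def restrictTo {X : Type*} (M : X → WithBot ℕ) (Y : Set X) (Z : Set (Valuation X)) :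
    Set (Valuation X) := {v ∈ Z | ∀ x, x ∈ Y ↔ LeBound (M x) (v x)}

/-- The integral points of `∏ y ∈ Y, [0, M y]`. -/
abbrev GridPoint {X : Type*} (M : X → WithBot ℕ) (Y : Set X) :=
  {u : Y → ℕ // ∀ y : Y, ((u y : ℕ) : WithBot ℕ) ≤ M y}

/-- The minimum of the cost on the points of the closure of `Z_Y` that project to `u`; it is
`+∞` if there is none. -/
def kappa {X : Type*} [Fintype X] (M : X → WithBot ℕ) (Y : Set X) (P : PricedZone X)
    (u : GridPoint M Y) : EReal :=
  ⨅ v ∈ {v ∈ closure (restrictTo M Y P.zone) | ∀ y : Y, v y = (u.1 y : ℝ≥0)},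
    ((P.cost.eval v : ℝ) : EReal)

/-! ### Regions and the corner-point abstraction -/

/-- Region equivalence with respect to the maximal constants `M`. -/
def RegionEquiv {X : Type*} (M : X → WithBot ℕ) (v v' : Valuation X) : Prop :=
  (∀ x, LeBound (M x) (v x) ↔ LeBound (M x) (v' x)) ∧
  (∀ x, LeBound (M x) (v x) → ⌊v x⌋₊ = ⌊v' x⌋₊ ∧
    (Int.fract (v x : ℝ) = 0 ↔ Int.fract (v' x : ℝ) = 0)) ∧
  (∀ x y, LeBound (M x) (v x) → LeBound (M y) (v y) →
    (Int.fract (v x : ℝ) ≤ Int.fract (v y : ℝ) ↔ Int.fract (v' x : ℝ) ≤ Int.fract (v' y : ℝ)))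

/-- Regions. -/
def IsRegion {X : Type*} (M : X → WithBot ℕ) (R : Set (Valuation X)) : Prop :=
  ∃ v, R = {v' | RegionEquiv M v v'}

/-- The set of clocks that are at most their bound in the region `R`. -/
def boundedClocks {X : Type*} (M : X → WithBot ℕ) (R : Set (Valuation X)) : Set X :=
  {x | ∀ v ∈ R, LeBound (M x) (v x)}

/-- `R'` is the immediate time successor of the region `R`. -/
def TimeSucc {X : Type*} (R R' : Set (Valuation X)) : Prop :=
  R' ≠ R ∧ ∃ v ∈ R, ∃ t : ℝ≥0, v.delay t ∈ R' ∧ ∀ t' ≤ t, v.delay t' ∈ R ∪ R'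

/-- States `(ℓ, (R, α))` of the corner-point abstraction: `R` is a region and `α` is a corner of
`R`, that is, an integral point of the closure of the projection of `R` to its bounded clocks. -/
structure CPState {X : Type*} (L : Type*) (M : X → WithBot ℕ) where
  loc : L
  region : Set (Valuation X)
  isRegion : IsRegion M region
  corner : boundedClocks M region → ℕ
  isCorner : (fun x => (corner x : ℝ≥0)) ∈ closure (proj (boundedClocks M region) '' region)

/-- Delay and discrete transitions. -/
inductive MoveKind
  | delay | discrete

/-- The weighted transitions of the corner-point abstraction. -/
inductive CPStep {X L : Type*} [DecidableEq X] (A : WTA X L) (M : X → WithBot ℕ) :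
    CPState L M → MoveKind → ℤ → CPState L M → Prop
  /-- From a corner to the corner of the same region that is one time unit later. -/
  | tick (s s' : CPState L M) (hl : s'.loc = s.loc) (hR : s'.region = s.region) (hne : s ≠ s')
      (hα : ∀ x h h', s'.corner ⟨x, h'⟩ = s.corner ⟨x, h⟩ + 1) :
      CPStep A M s .delay (A.locWeight s.loc) s'
  /-- One time unit spent in the region in which all clocks exceed their bounds. -/
  | idle (s : CPState L M) (hR : boundedClocks M s.region = ∅) :
      CPStep A M s .delay (A.locWeight s.loc) s
  /-- From a region to its time successor, with the same corner. Clocks that become unbounded are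
  forgotten. -/
  | cross (s s' : CPState L M) (hl : s'.loc = s.loc) (hR : TimeSucc s.region s'.region)
      (hα : ∀ x h h', s'.corner ⟨x, h'⟩ = s.corner ⟨x, h⟩) :
      CPStep A M s .delay 0 s'
  /-- Discrete transitions. -/
  | edge (s s' : CPState L M) (e : Edge X L) (he : e ∈ A.edges) (hs : e.src = s.loc)
      (ht : e.tgt = s'.loc) (hg : ∀ v ∈ s.region, e.guard.Sat v)
      (hR : ∀ v ∈ s.region, Valuation.reset e.reset v ∈ s'.region)
      (hα0 : ∀ x h', x ∈ e.reset → s'.corner ⟨x, h'⟩ = 0)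
      (hα : ∀ x h h', x ∉ e.reset → s'.corner ⟨x, h'⟩ = s.corner ⟨x, h⟩) :
      CPStep A M s .discrete (A.edgeWeight e) s'

/-- Finite paths of the corner-point abstraction, with the kinds and weights of their
transitions. -/
inductive CPPath {X L : Type*} [DecidableEq X] (A : WTA X L) (M : X → WithBot ℕ) :
    CPState L M → List (MoveKind × ℤ) → CPState L M → Prop
  | nil (s : CPState L M) : CPPath A M s [] s
  | cons {s s' s'' : CPState L M} {k : MoveKind} {w : ℤ} {p : List (MoveKind × ℤ)}
      (h : CPStep A M s k w s') (hp : CPPath A M s' p s'') : CPPath A M s ((k, w) :: p) s''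

theorem regionEquiv_refl {X : Type*} (M : X → WithBot ℕ) (v : Valuation X) : RegionEquiv M v v :=
  ⟨fun _ => Iff.rfl, fun _ _ => ⟨rfl, Iff.rfl⟩, fun _ _ _ _ => Iff.rfl⟩

/-- The initial state of the corner-point abstraction: the initial location, the region of the
valuation `0`, and the corner `0`. -/
def CPState.initial {X L : Type*} (A : WTA X L) (M : X → WithBot ℕ) : CPState L M where
  loc := A.init
  region := {v' | RegionEquiv M (fun _ => 0) v'}
  isRegion := ⟨_, rfl⟩
  corner := fun _ => 0
  isCorner := subset_closure ⟨fun _ => 0, regionEquiv_refl M _, by ext; simp [proj]⟩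

/-- There is a reachable cycle of negative cost that contains a discrete transition. -/
def HasNegativeNonDelayCycle {X L : Type*} [DecidableEq X] (A : WTA X L) (M : X → WithBot ℕ) :
    Prop :=
  ∃ (s : CPState L M) (p c : List (MoveKind × ℤ)),
    CPPath A M (CPState.initial A M) p s ∧ CPPath A M s c s ∧
    (c.map Prod.snd).sum < 0 ∧ ∃ w, (MoveKind.discrete, w) ∈ c

end PTA

end

namespace PTA

open Set Filter Topology

/-! ### Convex combinations of valuations -/

section Mix

variable {ι : Type*}

/-! Assume that there is no such cycle. It suffices to bound all the costs `ζ_i` from below by one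
constant: the entries of the tuples are then integers above a fixed bound or `+∞`, and by Dickson's
lemma (`exists_ne_le_of_bddBelow`) such tuples, with finitely many entries, cannot form an infinite
antichain. Integrality (`kappa_eq_top_or_intCast`) comes from rounding.

Rounding is the common tool. Fix a phase `φ`, read as the current absolute time, and replace it and
the times of all resets by their integral parts; a clock of value `a` becomes `⌊φ⌋ - ⌊φ - a⌋`. This
preserves all constraints with integral bounds, turns a valuation into a corner of its region, and
averages to `a` when `φ` runs through a unit interval. A run thus yields a path of the corner-point
abstraction for every phase, with the cost of the run as average weight, so that some path costs no
more than the run (`CPReach`, `CPReach.delay`, `CPReach.exists_path`).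

Costs of zones are related to such paths by the invariant `Traced`. The obstacle is idling at a
negative rate when all clocks are unbounded: it gives negative cycles made of delays only, which
prove nothing. The paths are therefore frugal, that is, they never idle in this way, and the cost
gained by idling shows up in the zone as a ray along which the cost decreases (`BadAt`). Such rays
survive all later operations, so a zone whose cost is bounded from below has none, and each of its
costs is, up to an error, at least the weight of a frugal path (`Explored.exists_frugalReach`).

Finally, a frugal cycle of delays cannot be negative, since a negative weight needs a tick, which
moves the corner strictly upwards. By assumption all reachable frugal cycles are then nonnegative;
removing them leaves paths without repeated states, in a finite graph, whose weights are bounded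
from below (`exists_frugalReach_bound`). -/

theorem mem_closure_of_mix {S : Set (ι → ℝ≥0)} {u z : ι → ℝ≥0}
    (h : ∀ a b : ℝ≥0, a + b = 1 → 0 < b → a • u + b • z ∈ S) : u ∈ closure S := by
  have hc : Continuous fun b : ℝ≥0 => (1 - b) • u + b • z := by fun_prop
  have ht : Tendsto (fun b : ℝ≥0 => (1 - b) • u + b • z) (𝓝[>] 0) (𝓝 u) := by
    have := (hc.tendsto 0).mono_left (nhdsWithin_le_nhds (s := Ioi 0))
    simpa using this
  refine mem_closure_of_tendsto ht ?_
  have h1 : ∀ᶠ b : ℝ≥0 in 𝓝[>] 0, b < 1 := nhdsWithin_le_nhds (Iio_mem_nhds zero_lt_one)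
  filter_upwards [h1, self_mem_nhdsWithin] with b hb hb0
  exact h _ _ (tsub_add_cancel_of_le hb.le) hb0

theorem coe_mix (a b : ℝ≥0) (u z : ι → ℝ≥0) (x : ι) :
    (((a • u + b • z) x : ℝ≥0) : ℝ) = a * u x + b * z x := by simp

end Mix

/-! ### Rounding of clock values -/

/-- A clock value, rounded as if the current time were `φ` and all time stamps were replaced by
their integral parts. -/
noncomputable def phaseRound (φ a : ℝ) : ℤ := ⌊φ⌋ - ⌊φ - a⌋

theorem phaseRound_zero (φ : ℝ) : phaseRound φ 0 = 0 := by simp [phaseRound]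

theorem phaseRound_nonneg {φ a : ℝ} (ha : 0 ≤ a) : 0 ≤ phaseRound φ a :=
  sub_nonneg.2 (Int.floor_le_floor (by linarith))

theorem coe_toNat_phaseRound (φ : ℝ) (a : ℝ≥0) :
    (((phaseRound φ a).toNat : ℝ≥0) : ℝ) = phaseRound φ a := by
  have h : ((phaseRound φ a).toNat : ℤ) = phaseRound φ a :=
    Int.toNat_of_nonneg (phaseRound_nonneg a.coe_nonneg)
  rw [NNReal.coe_natCast]
  exact_mod_cast congrArg (Int.cast : ℤ → ℝ) h

/-- In a difference of two rounded clocks the term `⌊φ⌋` cancels, and an integral bound passes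
through the floor. -/
theorem phaseRound_sub_le {φ a b : ℝ} {c : ℤ} (h : a - b ≤ c) :
    phaseRound φ a - phaseRound φ b ≤ c := by
  have : ⌊φ - b⌋ ≤ ⌊φ - a + c⌋ := Int.floor_le_floor (by linarith)
  rw [Int.floor_add_intCast] at this
  unfold phaseRound
  linarith

theorem phaseRound_le {φ a : ℝ} {c : ℤ} (h : a ≤ c) : phaseRound φ a ≤ c := by
  simpa [phaseRound_zero] using phaseRound_sub_le (φ := φ) (a := a) (b := 0) (by simpa using h)

theorem le_phaseRound {φ a : ℝ} {c : ℤ} (h : (c : ℝ) ≤ a) : c ≤ phaseRound φ a := by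
  have := phaseRound_sub_le (φ := φ) (a := 0) (b := a) (c := -c) (by push_cast; linarith)
  rw [phaseRound_zero] at this
  linarith

theorem phaseRound_intCast (φ : ℝ) (n : ℤ) : phaseRound φ n = n :=
  le_antisymm (phaseRound_le le_rfl) (le_phaseRound le_rfl)

/-- The phase acts as a threshold: exactly the clocks whose fractional part exceeds that of `φ` are
rounded up. This is why roundings are corners of regions. -/
theorem phaseRound_eq_floor_add (φ a : ℝ) :
    phaseRound φ a = ⌊a⌋ + if Int.fract φ < Int.fract a then 1 else 0 := by
  have h : φ - a = (Int.fract φ - Int.fract a) + ((⌊φ⌋ - ⌊a⌋ : ℤ) : ℝ) := by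
    push_cast; unfold Int.fract; ring
  unfold phaseRound
  rw [h, Int.floor_add_intCast]
  have h1 := Int.fract_nonneg φ
  have h2 := Int.fract_lt_one φ
  have h3 := Int.fract_nonneg a
  have h4 := Int.fract_lt_one a
  split_ifs with hlt
  · have : ⌊Int.fract φ - Int.fract a⌋ = -1 := by
      rw [Int.floor_eq_iff]; push_cast; constructor <;> linarith
    rw [this]; ring
  · have : ⌊Int.fract φ - Int.fract a⌋ = 0 := by
      rw [Int.floor_eq_iff]; push_cast; constructor <;> linarith
    rw [this]; ring

theorem phaseRound_add_one (φ a : ℝ) : phaseRound (φ + 1) a = phaseRound φ a := by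
  rw [phaseRound_eq_floor_add, phaseRound_eq_floor_add, Int.fract_add_one]

theorem intervalIntegrable_phaseRound (t a b : ℝ) :
    IntervalIntegrable (fun φ => (phaseRound φ t : ℝ)) MeasureTheory.volume a b := by
  have h1 : Monotone fun φ : ℝ => (⌊φ⌋ : ℝ) := fun x y h => by
    dsimp only
    exact_mod_cast Int.floor_le_floor h
  have h2 : Monotone fun φ : ℝ => (⌊φ - t⌋ : ℝ) := fun x y h => by
    dsimp only
    exact_mod_cast Int.floor_le_floor (sub_le_sub_right h t)
  simpa [phaseRound] using
    (h1.intervalIntegrable (a := a) (b := b) (μ := MeasureTheory.volume)).sub h2.intervalIntegrable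

/-- The rounded value differs from `t` by `fract (φ - t) - fract φ`, whose integral over a period
vanishes. -/
theorem integral_phaseRound (t : ℝ) : ∫ φ in (0 : ℝ)..1, (phaseRound φ t : ℝ) = t := by
  have hm (s : ℝ) : IntervalIntegrable (fun φ : ℝ => Int.fract (φ - s)) MeasureTheory.volume 0 1 := by
    have h2 : Monotone fun φ : ℝ => (⌊φ - s⌋ : ℝ) := fun x y h => by
      dsimp only
      exact_mod_cast Int.floor_le_floor (sub_le_sub_right h s)
    have h3 : Continuous fun φ : ℝ => φ - s := by fun_prop
    exact (h3.intervalIntegrable 0 1).sub h2.intervalIntegrable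
  have hper : ∫ φ in (0 : ℝ)..1, Int.fract (φ - t) = ∫ φ in (0 : ℝ)..1, Int.fract φ := by
    rw [intervalIntegral.integral_comp_sub_right (fun φ => Int.fract φ)]
    have := (Int.fract_periodic ℝ).intervalIntegral_add_eq (0 - t) 0
    rw [show (0 : ℝ) - t + 1 = 1 - t by ring, zero_add] at this
    exact this
  have h0 := hm 0
  simp only [sub_zero] at h0
  have : ∀ φ : ℝ, (phaseRound φ t : ℝ) = (Int.fract (φ - t) - Int.fract φ) + t := fun φ => by
    unfold phaseRound Int.fract; push_cast; ring
  simp_rw [this]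
  rw [intervalIntegral.integral_add ((hm t).sub h0) (by simp),
    intervalIntegral.integral_sub (hm t) h0, hper]
  simp

theorem exists_le_of_integral_le {W : ℝ → ℝ} (hW : IntervalIntegrable W MeasureTheory.volume 0 1)
    {c : ℝ} (hc : ∫ φ in (0 : ℝ)..1, W φ ≤ c) : ∃ φ, W φ ≤ c := by
  by_contra! h
  have h1 : ∫ φ in (0 : ℝ)..1, c < ∫ φ in (0 : ℝ)..1, W φ :=
    intervalIntegral.integral_lt_integral_of_ae_le_of_measure_setOfPred_lt_ne_zero zero_le_one
      (by simp) hW (Eventually.of_forall fun φ => (h φ).le) (by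
        have : {x | c < W x} = univ := by ext; simp [h]
        simp [this])
  simp at h1
  linarith

/-! ### Regions -/

section Regions

variable {X : Type*} {M : X → WithBot ℕ} {v v' v'' : Valuation X}

theorem RegionEquiv.symm (h : RegionEquiv M v v') : RegionEquiv M v' v :=
  ⟨fun x => (h.1 x).symm,
    fun x hx => ⟨(h.2.1 x ((h.1 x).2 hx)).1.symm, (h.2.1 x ((h.1 x).2 hx)).2.symm⟩,
    fun x y hx hy => (h.2.2 x y ((h.1 x).2 hx) ((h.1 y).2 hy)).symm⟩

theorem RegionEquiv.trans (h : RegionEquiv M v v') (h' : RegionEquiv M v' v'') :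
    RegionEquiv M v v'' :=
  ⟨fun x => (h.1 x).trans (h'.1 x),
    fun x hx => ⟨(h.2.1 x hx).1.trans (h'.2.1 x ((h.1 x).1 hx)).1,
      (h.2.1 x hx).2.trans (h'.2.1 x ((h.1 x).1 hx)).2⟩,
    fun x y hx hy => (h.2.2 x y hx hy).trans (h'.2.2 x y ((h.1 x).1 hx) ((h.1 y).1 hy))⟩

/-- The region of a valuation. -/
def regionOf (M : X → WithBot ℕ) (v : Valuation X) : Set (Valuation X) := {v' | RegionEquiv M v v'}

theorem self_mem_regionOf : v ∈ regionOf M v := regionEquiv_refl M v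

theorem regionOf_eq_of_equiv (h : RegionEquiv M v v') : regionOf M v = regionOf M v' :=
  Set.ext fun _ => ⟨fun hw => h.symm.trans hw, fun hw => h.trans hw⟩

theorem mem_boundedClocks_regionOf {x : X} :
    x ∈ boundedClocks M (regionOf M v) ↔ LeBound (M x) (v x) :=
  ⟨fun h => h v self_mem_regionOf, fun h _ hw => (hw.1 x).1 h⟩

theorem LeBound.mono {m : WithBot ℕ} {a b : ℝ≥0} (h : LeBound m b) (hab : a ≤ b) : LeBound m a :=
  let ⟨k, hk, hb⟩ := h
  ⟨k, hk, hab.trans hb⟩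

/-- The bound is an integer above `n`, hence at least `n + 1`. -/
theorem LeBound.of_open_unit {m : WithBot ℕ} {a b : ℝ≥0} {n : ℕ} (h : LeBound m a)
    (ha : (n : ℝ) < a) (hb : (b : ℝ) < n + 1) : LeBound m b := by
  obtain ⟨k, hk, hak⟩ := h
  refine ⟨k, hk, ?_⟩
  have h1 : (a : ℝ) ≤ k := by exact_mod_cast hak
  have h2 : (n : ℝ) < k := ha.trans_le h1
  have h3 : n + 1 ≤ k := by exact_mod_cast h2
  have h4 : (n : ℝ) + 1 ≤ k := by exact_mod_cast h3
  exact_mod_cast hb.le.trans h4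

theorem floor_eq_of_open_unit {a : ℝ≥0} {n : ℕ} (h1 : (n : ℝ) < a) (h2 : (a : ℝ) < n + 1) :
    ⌊a⌋₊ = n ∧ Int.fract (a : ℝ) = a - n := by
  constructor
  · rw [Nat.floor_eq_iff (by positivity)]
    exact ⟨by exact_mod_cast h1.le, by exact_mod_cast h2⟩
  · have : ⌊(a : ℝ)⌋ = n := by
      rw [Int.floor_eq_iff]; push_cast; exact ⟨h1.le, h2⟩
    rw [Int.fract, this]; simp

theorem regionEquiv_of_open_unit
    (h : ∀ x, ∃ n : ℕ, (n : ℝ) < v x ∧ (v x : ℝ) < n + 1 ∧ (n : ℝ) < v' x ∧ (v' x : ℝ) < n + 1)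
    (s : ℝ) (hs : ∀ x, (v' x : ℝ) = v x + s) : RegionEquiv M v v' := by
  choose n h1 h2 h3 h4 using h
  have f := fun x => floor_eq_of_open_unit (h1 x) (h2 x)
  have f' := fun x => floor_eq_of_open_unit (h3 x) (h4 x)
  refine ⟨fun x => ⟨fun hx => hx.of_open_unit (h1 x) (h4 x), fun hx => hx.of_open_unit (h3 x) (h2 x)⟩,
    fun x _ => ⟨(f x).1.trans (f' x).1.symm, ?_⟩, fun x y _ _ => ?_⟩
  · rw [(f x).2, (f' x).2]
    have := h1 x
    have := h3 x
    constructor <;> intro <;> linarith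
  · rw [(f x).2, (f' x).2, (f y).2, (f' y).2, hs x, hs y]
    constructor <;> intro <;> linarith

/-- Moving a valuation towards its rounding does not leave its region. -/
theorem regionEquiv_mix_phaseRound (φ : ℝ) {w : Valuation X} {a b : ℝ} (hab : a + b = 1)
    (hb : 0 < b) (ha : 0 ≤ a)
    (hw : ∀ x, LeBound (M x) (v x) → (w x : ℝ) = a * phaseRound φ (v x) + b * v x)
    (hw' : ∀ x, ¬ LeBound (M x) (v x) → w x = v x) : RegionEquiv M v w := by
  -- The new fractional part is a strictly increasing function of the old one that fixes `0` and
  -- stays below `1`. Hence integral parts, vanishing of fractional parts and their order are all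
  -- preserved.
  have key : ∀ x, LeBound (M x) (v x) → ⌊(w x : ℝ)⌋ = ⌊(v x : ℝ)⌋ ∧
      Int.fract (w x : ℝ) =
        a * (if Int.fract φ < Int.fract (v x : ℝ) then 1 else 0) + b * Int.fract (v x : ℝ) := by
    intro x hx
    have e : (w x : ℝ) = ⌊(v x : ℝ)⌋ +
        (a * (if Int.fract φ < Int.fract (v x : ℝ) then 1 else 0) + b * Int.fract (v x : ℝ)) := by
      rw [hw x hx, phaseRound_eq_floor_add]
      obtain rfl : a = 1 - b := by linarith
      have := Int.floor_add_fract (v x : ℝ)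
      push_cast
      nlinarith
    have h0 := Int.fract_nonneg (v x : ℝ)
    have h1 := Int.fract_lt_one (v x : ℝ)
    have h2 := Int.fract_nonneg φ
    have hfl : ⌊(w x : ℝ)⌋ = ⌊(v x : ℝ)⌋ := by
      rw [e, Int.floor_eq_iff]
      constructor
      · have : (0 : ℝ) ≤ if Int.fract φ < Int.fract (v x : ℝ) then 1 else 0 := by
          split_ifs <;> norm_num
        have := mul_nonneg ha this
        have := mul_nonneg hb.le h0
        linarith
      · split_ifs <;> nlinarith
    refine ⟨hfl, ?_⟩
    rw [Int.fract, hfl]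
    linarith
  have hbd : ∀ x, LeBound (M x) (v x) → LeBound (M x) (w x) := by
    rintro x ⟨k, hk, hx⟩
    refine ⟨k, hk, ?_⟩
    have h1 : (v x : ℝ) ≤ (k : ℤ) := by exact_mod_cast hx
    have h2 : (phaseRound φ (v x) : ℝ) ≤ k := by exact_mod_cast phaseRound_le (φ := φ) h1
    have h3 := hw x ⟨k, hk, hx⟩
    have : (w x : ℝ) ≤ k := by
      push_cast at h1
      rw [h3]
      obtain rfl : a = 1 - b := by linarith
      nlinarith
    exact_mod_cast this
  refine ⟨fun x => ⟨hbd x, fun h => ?_⟩, fun x hx => ⟨?_, ?_⟩, fun x y hx hy => ?_⟩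
  · by_contra hc
    rw [hw' x hc] at h
    exact hc h
  · have := (key x hx).1
    rw [← Int.natCast_floor_eq_floor (by positivity), ← Int.natCast_floor_eq_floor (by positivity)]
      at this
    have h2 : ⌊(w x : ℝ)⌋₊ = ⌊(v x : ℝ)⌋₊ := by exact_mod_cast this
    exact h2.symm
  · rw [(key x hx).2]
    have h0 := Int.fract_nonneg (v x : ℝ)
    have h2 := Int.fract_nonneg φ
    constructor
    · intro h
      rw [h, if_neg (by linarith)]; ring
    · intro h
      split_ifs at h <;> nlinarith
  · rw [(key x hx).2, (key y hy).2]
    have h0 := Int.fract_nonneg (v x : ℝ)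
    constructor
    · intro h
      split_ifs with h1 h2 h2
      · nlinarith
      · linarith
      · nlinarith
      · nlinarith
    · intro h
      by_contra! hc
      split_ifs at h with h1 h2 h2
      · nlinarith
      · nlinarith
      · linarith
      · nlinarith

end Regions

/-! ### States of the corner-point abstraction given by a valuation and a phase -/

section States

variable {X L : Type*} {M : X → WithBot ℕ}

theorem CPState.ext_of_corner {s s' : CPState L M} (hl : s.loc = s'.loc)
    (hR : s.region = s'.region) (hα : ∀ x h h', s.corner ⟨x, h⟩ = s'.corner ⟨x, h'⟩) : s = s' := by
  obtain ⟨l, R, hreg, α, hc⟩ := s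
  obtain ⟨l', R', hreg', α', hc'⟩ := s'
  dsimp only at hl hR hα
  subst hl hR
  obtain rfl : α = α' := funext fun x => hα x.1 x.2 x.2
  rfl

theorem CPState.corner_congr {s s' : CPState L M} (h : s = s') (x : X)
    (hx : x ∈ boundedClocks M s.region) (hx' : x ∈ boundedClocks M s'.region) :
    s.corner ⟨x, hx⟩ = s'.corner ⟨x, hx'⟩ := by
  subst h; rfl

/-- The segment from the rounding to `v`, without its first endpoint, projects from the region of
`v`. -/
theorem phaseRound_mem_closure (v : Valuation X) (φ : ℝ) :
    (fun x : boundedClocks M (regionOf M v) => (((phaseRound φ (v x)).toNat : ℕ) : ℝ≥0)) ∈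
      closure (proj (boundedClocks M (regionOf M v)) '' regionOf M v) := by
  classical
  refine mem_closure_of_mix (z := proj _ v) fun a b hab hb => ?_
  refine ⟨fun x => if x ∈ boundedClocks M (regionOf M v) then
    a * ((phaseRound φ (v x)).toNat : ℕ) + b * v x else v x, ?_, ?_⟩
  · refine regionEquiv_mix_phaseRound φ (a := a) (b := b) (by exact_mod_cast hab)
      (by exact_mod_cast hb) a.2 (fun x hx => ?_) fun x hx => ?_
    · rw [if_pos (mem_boundedClocks_regionOf.2 hx)]
      rw [NNReal.coe_add, NNReal.coe_mul, NNReal.coe_mul, coe_toNat_phaseRound]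
    · exact if_neg fun h => hx (mem_boundedClocks_regionOf.1 h)
  · ext x
    simp [proj, x.2]

/-- The state of the corner-point abstraction reached at the phase `φ` with the valuation `v`. -/
noncomputable def CPState.ofVal (M : X → WithBot ℕ) (l : L) (v : Valuation X) (φ : ℝ) :
    CPState L M where
  loc := l
  region := regionOf M v
  isRegion := ⟨v, rfl⟩
  corner x := (phaseRound φ (v x)).toNat
  isCorner := phaseRound_mem_closure v φ

theorem CPState.ofVal_eq_of_equiv {l : L} {v v' : Valuation X} {φ φ' : ℝ} (h : RegionEquiv M v v')
    (hφ : ∀ x, LeBound (M x) (v x) → phaseRound φ (v x) = phaseRound φ' (v' x)) :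
    CPState.ofVal M l v φ = CPState.ofVal M l v' φ' :=
  CPState.ext_of_corner rfl (regionOf_eq_of_equiv h) fun x hx hx' => by
    change (phaseRound φ (v x)).toNat = (phaseRound φ' (v' x)).toNat
    rw [hφ x (mem_boundedClocks_regionOf.1 hx)]

theorem CPState.initial_eq_ofVal (A : WTA X L) (φ : ℝ) :
    CPState.initial A M = CPState.ofVal M A.init (fun _ => 0) φ :=
  CPState.ext_of_corner rfl rfl fun x _ _ => by
    change 0 = (phaseRound φ ((0 : ℝ≥0) : ℝ)).toNat
    simp [phaseRound_zero]

theorem delay_zero (v : Valuation X) : v.delay 0 = v := by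
  ext; simp [Valuation.delay]

theorem delay_delay (v : Valuation X) (s t : ℝ≥0) : (v.delay s).delay t = v.delay (s + t) := by
  ext; simp [Valuation.delay, add_assoc]

theorem regionEquiv_delay {v : Valuation X} {s t : ℝ≥0}
    (h : ∀ x, ∃ n : ℕ, (n : ℝ) < v x + s ∧ (n : ℝ) < v x + t ∧ (v x + s : ℝ) < n + 1 ∧
      (v x + t : ℝ) < n + 1) : RegionEquiv M (v.delay s) (v.delay t) := by
  refine regionEquiv_of_open_unit (fun x => ?_) (t - s) fun x => ?_
  · obtain ⟨n, h1, h2, h3, h4⟩ := h x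
    exact ⟨n, by simpa [Valuation.delay] using h1, by simpa [Valuation.delay] using h3,
      by simpa [Valuation.delay] using h2, by simpa [Valuation.delay] using h4⟩
  · simp [Valuation.delay]

theorem phaseRound_delay (v : Valuation X) (φ : ℝ) (t : ℝ≥0) (x : X) :
    phaseRound (φ + t) (v.delay t x) = phaseRound φ (v x) + (⌊φ + t⌋ - ⌊φ⌋) := by
  have : φ + t - (v.delay t x : ℝ≥0) = φ - v x := by simp [Valuation.delay]
  unfold phaseRound
  rw [this]; ring

end States

/-! ### Paths that never idle at a negative rate -/

section Paths

variable {X L : Type*} [DecidableEq X] {A : WTA X L} {M : X → WithBot ℕ}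

/-- Transitions other than delays of negative weight in the region where all clocks are
unbounded. -/
def FrugalStep (A : WTA X L) (M : X → WithBot ℕ) (s : CPState L M) (k : MoveKind) (w : ℤ)
    (s' : CPState L M) : Prop :=
  CPStep A M s k w s' ∧ (k = .delay → boundedClocks M s.region = ∅ → 0 ≤ w)

/-- Paths consisting of frugal steps, with the list of the states in which the steps start. -/
inductive FrugalPath (A : WTA X L) (M : X → WithBot ℕ) :
    CPState L M → List (CPState L M) → List (MoveKind × ℤ) → CPState L M → Prop
  | nil (s : CPState L M) : FrugalPath A M s [] [] s
  | cons {s s' s'' : CPState L M} {l : List (CPState L M)} {k : MoveKind} {w : ℤ}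
      {p : List (MoveKind × ℤ)} (h : FrugalStep A M s k w s') (hp : FrugalPath A M s' l p s'') :
      FrugalPath A M s (s :: l) ((k, w) :: p) s''

/-- There is a frugal path of weight at most `c`. -/
def FrugalReach (A : WTA X L) (M : X → WithBot ℕ) (s s' : CPState L M) (c : ℝ) : Prop :=
  ∃ l p, FrugalPath A M s l p s' ∧ ((p.map Prod.snd).sum : ℝ) ≤ c

theorem FrugalPath.append {s s' s'' : CPState L M} {l l' : List (CPState L M)}
    {p p' : List (MoveKind × ℤ)} (h : FrugalPath A M s l p s') (h' : FrugalPath A M s' l' p' s'') :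
    FrugalPath A M s (l ++ l') (p ++ p') s'' := by
  induction h with
  | nil => exact h'
  | cons h _ ih => exact .cons h (ih h')

theorem FrugalReach.refl (s : CPState L M) {c : ℝ} (hc : 0 ≤ c) : FrugalReach A M s s c :=
  ⟨[], [], .nil s, by simpa using hc⟩

theorem FrugalReach.trans {s s' s'' : CPState L M} {c c' d : ℝ} (h : FrugalReach A M s s' c)
    (h' : FrugalReach A M s' s'' c') (hd : c + c' ≤ d) : FrugalReach A M s s'' d := by
  obtain ⟨l, p, hp, hc⟩ := h
  obtain ⟨l', p', hp', hc'⟩ := h'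
  exact ⟨_, _, hp.append hp', by rw [List.map_append, List.sum_append]; push_cast at *; linarith⟩

theorem FrugalReach.mono {s s' : CPState L M} {c d : ℝ} (h : FrugalReach A M s s' c)
    (hd : c ≤ d) : FrugalReach A M s s' d :=
  let ⟨l, p, hp, hc⟩ := h
  ⟨l, p, hp, hc.trans hd⟩

theorem FrugalReach.of_step {s s' : CPState L M} {k : MoveKind} {w : ℤ}
    (h : FrugalStep A M s k w s') {c : ℝ} (hc : (w : ℝ) ≤ c) : FrugalReach A M s s' c :=
  ⟨_, _, .cons h (.nil s'), by simpa using hc⟩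

/-! ### Delays -/

/-- Crossing to the next region, or staying in the same one, without changing the corner. -/
theorem frugalReach_cross {l : L} {v v' : Valuation X} {φ φ' : ℝ} {t : ℝ≥0} (hv' : v' = v.delay t)
    (hR : ∀ t' ≤ t, RegionEquiv M v (v.delay t') ∨ RegionEquiv M v' (v.delay t'))
    (hα : ∀ x, phaseRound φ (v x) = phaseRound φ' (v' x)) {c : ℝ} (hc : 0 ≤ c) :
    FrugalReach A M (CPState.ofVal M l v φ) (CPState.ofVal M l v' φ') c := by
  -- A crossing requires two distinct regions; if the regions agree, the two states are equal and
  -- the empty path serves.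
  by_cases h : RegionEquiv M v v'
  · rw [CPState.ofVal_eq_of_equiv h fun x _ => hα x]
    exact .refl _ hc
  · refine .of_step (k := .delay) (w := 0) ⟨.cross (CPState.ofVal M l v φ)
      (CPState.ofVal M l v' φ') rfl ⟨fun he => h ?_, v, self_mem_regionOf, t, ?_,
      fun t' ht' => hR t' ht'⟩ fun x _ _ => ?_, fun _ _ => le_rfl⟩ (by simpa using hc)
    · change regionOf M v' = regionOf M v at he
      have : v' ∈ regionOf M v := he ▸ self_mem_regionOf
      exact this
    · exact hv' ▸ self_mem_regionOf
    · change (phaseRound φ' (v' x)).toNat = (phaseRound φ (v x)).toNat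
      rw [hα]

/-- A delay during which neither a clock nor the phase reaches an integer. -/
theorem frugalReach_delay_right {l : L} {v : Valuation X} {φ : ℝ} {t : ℝ≥0}
    (hv : ∀ x, (v x + t : ℝ) < ⌊v x⌋₊ + 1) (hφ : φ + t < ⌊φ⌋ + 1) :
    FrugalReach A M (CPState.ofVal M l v φ) (CPState.ofVal M l (v.delay t) (φ + t)) 0 := by
  refine frugalReach_cross rfl (fun t' ht' => ?_) (fun x => ?_) le_rfl
  · rcases eq_or_ne t' 0 with rfl | h0
    · rw [delay_zero]; exact .inl (regionEquiv_refl M v)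
    · refine .inr (regionEquiv_delay fun x => ⟨⌊v x⌋₊, ?_, ?_, hv x, ?_⟩)
      all_goals
        have h1 : (⌊v x⌋₊ : ℝ) ≤ v x := by exact_mod_cast Nat.floor_le (zero_le (a := v x))
        have h2 : (0 : ℝ) < t' := by exact_mod_cast pos_iff_ne_zero.2 h0
        have h3 : (t' : ℝ) ≤ t := by exact_mod_cast ht'
        have h4 := hv x
        linarith
  · rw [phaseRound_delay]
    have : ⌊φ + t⌋ = ⌊φ⌋ := by
      rw [Int.floor_eq_iff]
      exact ⟨(Int.floor_le φ).trans (by simp), hφ⟩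
    rw [this]; ring

/-- One time unit for the corner, in the region of `v`. -/
theorem frugalReach_tick {l : L} {v : Valuation X} {φ φ' : ℝ}
    (hα : ∀ x, phaseRound φ' (v x) = phaseRound φ (v x) + 1) {e : ℤ}
    (he : A.locWeight l ≤ e) (he' : 0 ≤ e ∨ ∃ x, LeBound (M x) (v x)) :
    FrugalReach A M (CPState.ofVal M l v φ) (CPState.ofVal M l v φ') e := by
  -- Without bounded clocks the corner has no coordinates, so the states coincide. The empty path
  -- then replaces the idling step; its weight `0` is allowed because `0 ≤ e`.
  by_cases hb : ∃ x, LeBound (M x) (v x)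
  · obtain ⟨x, hx⟩ := hb
    have hx' : x ∈ boundedClocks M (CPState.ofVal M l v φ).region := mem_boundedClocks_regionOf.2 hx
    have hc : ∀ y h h', (CPState.ofVal M l v φ').corner ⟨y, h'⟩ =
        (CPState.ofVal M l v φ).corner ⟨y, h⟩ + 1 := fun y _ _ => by
      change (phaseRound φ' (v y)).toNat = (phaseRound φ (v y)).toNat + 1
      have := phaseRound_nonneg (φ := φ) (v y).coe_nonneg
      rw [hα]
      omega
    refine .of_step (k := .delay) (w := A.locWeight l) ⟨.tick (CPState.ofVal M l v φ)
      (CPState.ofVal M l v φ') rfl rfl (fun h => ?_) hc,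
      fun _ h => ?_⟩ (by exact_mod_cast he)
    · have h1 := hc x hx' (h ▸ hx')
      have h2 := CPState.corner_congr h x hx' (h ▸ hx')
      omega
    · rw [h] at hx'
      exact hx'.elim
  · have heq : CPState.ofVal M l v φ = CPState.ofVal M l v φ' :=
      CPState.ofVal_eq_of_equiv (regionEquiv_refl M v) fun x hx => (hb ⟨x, hx⟩).elim
    rw [← heq]
    exact .refl _ (by exact_mod_cast he'.resolve_right hb)

/-- A delay during which neither a clock nor the phase leaves an integer or passes through one. -/
theorem frugalReach_delay_left {l : L} {v : Valuation X} {φ : ℝ} {t : ℝ≥0}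
    (hv : ∀ x, (⌈(v x + t : ℝ)⌉ : ℝ) - 1 < v x) (hφ : (⌈φ + t⌉ : ℝ) - 1 < φ) {e : ℤ}
    (he : A.locWeight l ≤ e) (he' : 0 ≤ e ∨ ∃ x, LeBound (M x) (v x)) :
    FrugalReach A M (CPState.ofVal M l v φ) (CPState.ofVal M l (v.delay t) (φ + t))
      (e * (⌊φ + t⌋ - ⌊φ⌋ : ℤ)) := by
  rcases eq_or_ne t 0 with rfl | h0
  · rw [delay_zero]
    simpa using FrugalReach.refl (A := A) (CPState.ofVal M l v φ) le_rfl
  have ht : (0 : ℝ) < t := by exact_mod_cast pos_iff_ne_zero.2 h0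
  have hR : ∀ t' ≤ t, RegionEquiv M v (v.delay t') ∨ RegionEquiv M (v.delay t) (v.delay t') := by
    intro t' ht'
    rcases eq_or_lt_of_le ht' with rfl | hlt
    · exact .inr (regionEquiv_refl M _)
    · left
      have := regionEquiv_delay (M := M) (v := v) (s := 0) (t := t') fun x => by
        have h1 : 0 < ⌈(v x + t : ℝ)⌉ := Int.ceil_pos.2 (by have := (v x).2; positivity)
        refine ⟨(⌈(v x + t : ℝ)⌉ - 1).toNat, ?_⟩
        have h2 : (((⌈(v x + t : ℝ)⌉ - 1).toNat : ℕ) : ℝ) = (⌈(v x + t : ℝ)⌉ : ℝ) - 1 := by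
          have : ((⌈(v x + t : ℝ)⌉ - 1).toNat : ℤ) = ⌈(v x + t : ℝ)⌉ - 1 :=
            Int.toNat_of_nonneg (by omega)
          exact_mod_cast congrArg (Int.cast : ℤ → ℝ) this
        rw [h2]
        have h3 := hv x
        have h4 := Int.le_ceil (v x + t : ℝ)
        have h5 : (t' : ℝ) < t := by exact_mod_cast hlt
        have h6 := t'.coe_nonneg
        rw [NNReal.coe_zero]
        refine ⟨?_, ?_, ?_, ?_⟩ <;> linarith
      rwa [delay_zero] at this
  have hfl : ⌊φ + t⌋ = ⌊φ⌋ ∨ ⌊φ + t⌋ = ⌊φ⌋ + 1 := by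
    have h1 : ⌊φ⌋ ≤ ⌊φ + t⌋ := Int.floor_le_floor (by linarith)
    have h2 : (⌊φ + t⌋ : ℝ) ≤ ⌈φ + t⌉ := by exact_mod_cast Int.floor_le_ceil _
    have h3 := Int.lt_floor_add_one φ
    have h4 : (⌊φ + t⌋ : ℝ) < ⌊φ⌋ + 2 := by linarith
    have h5 : ⌊φ + t⌋ < ⌊φ⌋ + 2 := by exact_mod_cast h4
    omega
  rcases hfl with hfl | hfl
  · refine frugalReach_cross rfl hR (fun x => ?_) (by simp [hfl])
    rw [phaseRound_delay, hfl]; ring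
  · have hN : φ + t = ((⌊φ⌋ + 1 : ℤ) : ℝ) := by
      apply le_antisymm
      · refine (Int.le_ceil _).trans ?_
        have h3 := Int.lt_floor_add_one φ
        have : (⌈φ + t⌉ : ℝ) < ((⌊φ⌋ + 2 : ℤ) : ℝ) := by push_cast; linarith
        have : ⌈φ + t⌉ < ⌊φ⌋ + 2 := by exact_mod_cast this
        exact_mod_cast (by omega : ⌈φ + t⌉ ≤ ⌊φ⌋ + 1)
      · rw [← hfl]; exact Int.floor_le _
    -- With `v` kept fixed, advancing the phase leaves the rounded reset times unchanged and raises
    -- only the rounded current time. The corner thus ticks inside the region of `v`, and the region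
    -- is left afterwards at weight `0`.
    have hsh : ∀ x, phaseRound (φ + t) (v x) = phaseRound φ (v x) + 1 := by
      intro x
      have h1 := hv x
      have h2 := Int.le_ceil (v x + t : ℝ)
      have : ⌊φ + t - v x⌋ = ⌊φ - v x⌋ := by
        have e1 : ⌊φ + t - v x⌋ = ⌊φ⌋ + 1 - ⌈(v x + t : ℝ)⌉ := by
          rw [Int.floor_eq_iff, hN]; push_cast; constructor <;> linarith
        have e2 : ⌊φ - v x⌋ = ⌊φ⌋ + 1 - ⌈(v x + t : ℝ)⌉ := by
          rw [Int.floor_eq_iff, show φ = ((⌊φ⌋ + 1 : ℤ) : ℝ) - t by linarith]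
          have : ⌊((⌊φ⌋ + 1 : ℤ) : ℝ) - t⌋ = ⌊φ⌋ := congrArg _ (by linarith)
          rw [this]
          push_cast; constructor <;> linarith
        rw [e1, e2]
      unfold phaseRound
      rw [this, hfl]; ring
    refine (frugalReach_tick hsh he he').trans
      (frugalReach_cross rfl hR (φ' := φ + t) (fun x => ?_) le_rfl) (by simp [hfl])
    rw [hsh, phaseRound_delay, hfl]; ring

variable [Finite X]

/-- A delay of `t` time units in the location `l` gives a path whose weight is the rounded time
multiplied by the rate. -/
theorem frugalReach_delay {l : L} {v : Valuation X} (φ : ℝ) (t : ℝ≥0) {e : ℤ}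
    (he : A.locWeight l ≤ e) (he' : 0 ≤ e ∨ ∃ x, LeBound (M x) (v x + t)) :
    FrugalReach A M (CPState.ofVal M l v φ) (CPState.ofVal M l (v.delay t) (φ + t))
      (e * (⌊φ + t⌋ - ⌊φ⌋ : ℤ)) := by
  -- Continuous induction on the elapsed time: `S` contains `0`, contains its supremum by
  -- `frugalReach_delay_left`, and can be extended to the right of any of its points below `t` by
  -- `frugalReach_delay_right`.
  set S : Set ℝ≥0 := {s | s ≤ t ∧ FrugalReach A M (CPState.ofVal M l v φ)
    (CPState.ofVal M l (v.delay s) (φ + s)) (e * (⌊φ + s⌋ - ⌊φ⌋ : ℤ))} with hS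
  have h0 : (0 : ℝ≥0) ∈ S :=
    ⟨zero_le, by rw [delay_zero]; simpa using FrugalReach.refl (A := A) _ le_rfl⟩
  have hbdd : BddAbove S := ⟨t, fun s hs => hs.1⟩
  have hσt : sSup S ≤ t := csSup_le ⟨0, h0⟩ fun s hs => hs.1
  have hσ : sSup S ∈ S := by
    rcases eq_or_ne (sSup S) 0 with hz | hz
    · rwa [hz]
    have hev : ∀ᶠ s : ℝ≥0 in 𝓝[<] (sSup S),
        (∀ x, (⌈(v x + (sSup S : ℝ≥0) : ℝ)⌉ : ℝ) - 1 < v x + s) ∧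
          (⌈φ + (sSup S : ℝ≥0)⌉ : ℝ) - 1 < φ + s := by
      refine nhdsWithin_le_nhds (Filter.Eventually.and (eventually_all.2 fun x => ?_) ?_)
      · have hc : Continuous fun s : ℝ≥0 => (v x + s : ℝ) := by fun_prop
        exact hc.continuousAt.eventually (lt_mem_nhds (by
          have := Int.ceil_lt_add_one (v x + (sSup S : ℝ≥0) : ℝ)
          linarith))
      · have hc : Continuous fun s : ℝ≥0 => (φ + s : ℝ) := by fun_prop
        exact hc.continuousAt.eventually (lt_mem_nhds (by
          have := Int.ceil_lt_add_one (φ + (sSup S : ℝ≥0) : ℝ)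
          linarith))
    -- Close enough to the supremum on its left, the remaining delay contains no integral value of a
    -- clock or of the phase except possibly at its end.
    obtain ⟨b, hb, hbS⟩ := (mem_nhdsLT_iff_exists_Ioo_subset' (pos_iff_ne_zero.2 hz)).1 hev
    obtain ⟨s, hs, hbs⟩ := exists_lt_of_lt_csSup ⟨0, h0⟩ hb
    rcases eq_or_lt_of_le (le_csSup hbdd hs) with heq | hlt
    · rwa [← heq]
    obtain ⟨hx, hp⟩ := hbS ⟨hbs, hlt⟩
    obtain ⟨r, hr⟩ := exists_add_of_le hlt.le
    refine ⟨hσt, ?_⟩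
    rw [hr] at hx hp ⊢
    have hst : s + r ≤ t := hr ▸ hσt
    rw [← delay_delay]
    push_cast at hx hp ⊢
    rw [← add_assoc φ]
    refine hs.2.trans (frugalReach_delay_left (v := v.delay s) (φ := φ + s) (t := r) (e := e)
      (fun x => ?_) ?_ he ?_) (by push_cast; linarith)
    · simpa [Valuation.delay, add_assoc] using hx x
    · simpa [add_assoc] using hp
    · refine he'.imp_right fun ⟨x, hx⟩ => ⟨x, hx.mono ?_⟩
      exact add_le_add_right hs.1 (v x)
  rcases eq_or_lt_of_le hσt with heq | hlt
  · rw [heq] at hσ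
    exact hσ.2
  exfalso
  set σ := sSup S with hσdef
  -- If the supremum were below `t`, a short further delay would avoid all subsequent integers and
  -- give a larger element of `S`.
  have hev : ∀ᶠ r : ℝ≥0 in 𝓝[>] 0, r ∈ Ioi 0 ∧ σ + r < t ∧
      (∀ x, (v.delay σ x + r : ℝ) < ⌊v.delay σ x⌋₊ + 1) ∧ (φ + σ + r : ℝ) < ⌊φ + σ⌋ + 1 := by
    refine Filter.Eventually.and self_mem_nhdsWithin
      (nhdsWithin_le_nhds (Filter.Eventually.and ?_ (Filter.Eventually.and (eventually_all.2 fun x => ?_) ?_)))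
    · have hc : Continuous fun r : ℝ≥0 => σ + r := by fun_prop
      exact hc.continuousAt.eventually (gt_mem_nhds (by simpa using hlt))
    · have hc : Continuous fun r : ℝ≥0 => (v.delay σ x + r : ℝ) := by fun_prop
      exact hc.continuousAt.eventually (gt_mem_nhds (by
        simpa using (by exact_mod_cast Nat.lt_floor_add_one (v.delay σ x) :
          ((v.delay σ x : ℝ≥0) : ℝ) < ⌊v.delay σ x⌋₊ + 1)))
    · have hc : Continuous fun r : ℝ≥0 => (φ + σ + r : ℝ) := by fun_prop
      exact hc.continuousAt.eventually (gt_mem_nhds (by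
        simp))
  obtain ⟨r, hr0, hrt, hx, hp⟩ := hev.exists
  have hmem : σ + r ∈ S := by
    refine ⟨hrt.le, ?_⟩
    rw [← delay_delay]
    push_cast
    rw [← add_assoc φ]
    refine hσ.2.trans (frugalReach_delay_right (v := v.delay σ) (φ := φ + σ) (t := r) hx hp) ?_
    have : ⌊φ + σ + r⌋ = ⌊φ + σ⌋ := by
      rw [Int.floor_eq_iff]
      exact ⟨(Int.floor_le _).trans (by simp), hp⟩
    rw [this]; simp
  have : σ + r ≤ σ := le_csSup hbdd hmem
  have h1 : σ < σ + r := lt_add_of_pos_right σ hr0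
  exact absurd this (not_le.2 h1)

end Paths

/-! ### Guards and resets on regions -/

section RegionOps

variable {X : Type*} {M : X → WithBot ℕ} {v v' : Valuation X}

theorem le_natCast_iff_floor_fract {a : ℝ≥0} {c : ℕ} :
    (a : ℝ) ≤ c ↔ ⌊a⌋₊ < c ∨ (⌊a⌋₊ = c ∧ Int.fract (a : ℝ) = 0) := by
  have hf : (⌊a⌋₊ : ℝ) + Int.fract (a : ℝ) = a := by
    have : ((⌊(a : ℝ)⌋₊ : ℤ) : ℝ) = ⌊(a : ℝ)⌋ := by
      exact_mod_cast Int.natCast_floor_eq_floor a.coe_nonneg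
    have h2 := Int.floor_add_fract (a : ℝ)
    rw [← this] at h2
    exact h2
  have h0 := Int.fract_nonneg (a : ℝ)
  have h1 := Int.fract_lt_one (a : ℝ)
  constructor
  · intro h
    rcases lt_trichotomy ⌊a⌋₊ c with hlt | heq | hgt
    · exact .inl hlt
    · refine .inr ⟨heq, ?_⟩
      rw [heq] at hf
      linarith
    · have : (c : ℝ) + 1 ≤ ⌊a⌋₊ := by exact_mod_cast hgt
      linarith
  · rintro (h | ⟨h, h'⟩)
    · have : (⌊a⌋₊ : ℝ) + 1 ≤ c := by exact_mod_cast h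
      linarith
    · rw [← hf, h, h']; simp

theorem not_leBound_lt {m : WithBot ℕ} {c : ℕ} {a : ℝ≥0} (hc : (c : WithBot ℕ) ≤ m)
    (h : ¬ LeBound m a) : (c : ℝ) < a := by
  by_contra! hle
  induction m with
  | bot => simp at hc
  | coe k =>
    refine h ⟨k, rfl, ?_⟩
    have : c ≤ k := WithBot.coe_le_coe.1 hc
    have h2 : a ≤ c := by exact_mod_cast hle
    exact h2.trans (by exact_mod_cast this)

/-- For a bounded clock, comparison with an integer depends only on the integral part and on whether
the fractional part vanishes; an unbounded clock exceeds every constant of the guards. -/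
theorem RegionEquiv.holds {a : ClockAtom X} (h : RegionEquiv M v v')
    (hc : (a.const : WithBot ℕ) ≤ M a.clock) (hv : a.rel.Holds (v a.clock) a.const) :
    a.rel.Holds (v' a.clock) a.const := by
  have hlt : (v a.clock : ℝ) < a.const ↔ (v' a.clock : ℝ) < a.const := by
    by_cases hb : LeBound (M a.clock) (v a.clock)
    · have e : ∀ b : ℝ≥0, (b : ℝ) < a.const ↔ ⌊b⌋₊ < a.const := fun b => by
        rw [Nat.floor_lt (zero_le (a := b))]; exact_mod_cast Iff.rfl
      rw [e, e, (h.2.1 _ hb).1]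
    · have h1 := not_leBound_lt hc hb
      have h2 := not_leBound_lt hc fun hb' => hb ((h.1 _).2 hb')
      constructor <;> intro <;> linarith
  have hle : (v a.clock : ℝ) ≤ a.const ↔ (v' a.clock : ℝ) ≤ a.const := by
    by_cases hb : LeBound (M a.clock) (v a.clock)
    · rw [le_natCast_iff_floor_fract, le_natCast_iff_floor_fract, (h.2.1 _ hb).1, (h.2.1 _ hb).2]
    · have h1 := not_leBound_lt hc hb
      have h2 := not_leBound_lt hc fun hb' => hb ((h.1 _).2 hb')
      constructor <;> intro <;> linarith
  cases hr : a.rel <;> rw [hr] at hv <;> simp only [Cmp.Holds] at hv ⊢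
  · exact hlt.1 hv
  · exact hle.1 hv
  · exact le_antisymm (hle.1 hv.le) (not_lt.1 fun hc => (hlt.2 hc).ne hv)
  · exact not_lt.1 fun hc => not_le.2 (hlt.2 hc) hv
  · exact not_le.1 fun hc => not_lt.2 (hle.2 hc) hv

theorem RegionEquiv.reset [DecidableEq X] (h : RegionEquiv M v v') (Y : Finset X) :
    RegionEquiv M (v.reset Y) (v'.reset Y) := by
  refine ⟨fun x => ?_, fun x => ?_, fun x y => ?_⟩
  · by_cases hx : x ∈ Y
    · simp [Valuation.reset, hx]
    · simpa [Valuation.reset, hx] using h.1 x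
  · by_cases hx : x ∈ Y
    · simp [Valuation.reset, hx]
    · simpa [Valuation.reset, hx] using h.2.1 x
  · intro hbx hby
    by_cases hx : x ∈ Y
    · simp [Valuation.reset, hx]
    · by_cases hy : y ∈ Y
      · simp only [Valuation.reset, hx, hy, if_true, if_false, NNReal.coe_zero, Int.fract_zero] at hbx ⊢
        have e : ∀ r : ℝ, Int.fract r ≤ 0 ↔ Int.fract r = 0 := fun r =>
          ⟨fun h => le_antisymm h (Int.fract_nonneg r), fun h => h.le⟩
        rw [e, e]
        exact (h.2.1 x hbx).2
      · simp only [Valuation.reset, hx, hy, if_false] at hbx hby ⊢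
        exact h.2.2 x y hbx hby

end RegionOps

/-! ### Costs of concrete runs, compared with the corner-point abstraction -/

section Reach

variable {X L : Type*} [DecidableEq X] {A : WTA X L} {M : X → WithBot ℕ}

/-- For all phases there is a frugal path to the state given by the valuation and the phase, and
the weight of these paths is at most `c` on average. -/
def CPReach (A : WTA X L) (M : X → WithBot ℕ) (l : L) (v : Valuation X) (c : ℝ) : Prop :=
  ∃ W : ℝ → ℝ, Function.Periodic W 1 ∧ (∀ a b, IntervalIntegrable W MeasureTheory.volume a b) ∧
    ∫ φ in (0 : ℝ)..1, W φ ≤ c ∧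
    ∀ φ, FrugalReach A M (CPState.initial A M) (CPState.ofVal M l v φ) (W φ)

theorem cpReach_initial : CPReach A M A.init (fun _ => 0) 0 :=
  ⟨fun _ => 0, fun _ => rfl, fun _ _ => by simp, by simp, fun φ => by
    rw [CPState.initial_eq_ofVal A φ]
    exact .refl _ le_rfl⟩

theorem CPReach.exists_path {l : L} {v : Valuation X} {c : ℝ} (h : CPReach A M l v c) :
    ∃ s, FrugalReach A M (CPState.initial A M) s c := by
  obtain ⟨W, -, hi, hc, hp⟩ := h
  obtain ⟨φ, hφ⟩ := exists_le_of_integral_le (hi 0 1) hc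
  exact ⟨_, (hp φ).mono hφ⟩

/-- Phase `φ` after the delay corresponds to phase `φ - t` before it. By periodicity this shift does
not change the average weight, and the rounded durations average to `t`. The charged rate `e` may
exceed the actual one, so that a delay at a negative rate among unbounded clocks can be charged `0`.
-/
theorem CPReach.delay [Finite X] {l : L} {v : Valuation X} {c : ℝ} (h : CPReach A M l v c)
    (t : ℝ≥0) {e : ℤ} (he : A.locWeight l ≤ e) (he' : 0 ≤ e ∨ ∃ x, LeBound (M x) (v x + t)) :
    CPReach A M l (v.delay t) (c + e * t) := by
  obtain ⟨W, hper, hi, hc, hp⟩ := h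
  have hi' : ∀ a b, IntervalIntegrable (fun φ => W (φ - t)) MeasureTheory.volume a b :=
    fun a b => by simpa using (hi (a - t) (b - t)).comp_sub_right t
  have hr := fun a b => (intervalIntegrable_phaseRound t a b).const_mul (e : ℝ)
  refine ⟨fun φ => W (φ - t) + e * phaseRound φ t, fun φ => ?_, fun a b => (hi' a b).add (hr a b),
    ?_, fun φ => ?_⟩
  · dsimp only
    rw [phaseRound_add_one, show φ + 1 - (t : ℝ) = φ - t + 1 by ring, hper]
  · rw [intervalIntegral.integral_add (hi' 0 1) (hr 0 1), intervalIntegral.integral_const_mul,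
      integral_phaseRound, intervalIntegral.integral_comp_sub_right W]
    have := hper.intervalIntegral_add_eq (0 - (t : ℝ)) 0
    rw [show (0 : ℝ) - t + 1 = 1 - t by ring, zero_add] at this
    rw [this]
    linarith
  · have := frugalReach_delay (A := A) (l := l) (v := v) (φ - t) t he he'
    rw [sub_add_cancel] at this
    exact (hp (φ - t)).trans this (by simp [phaseRound])

theorem CPReach.edge (hM : IsMaxConst A M) {e : Edge X L} (he : e ∈ A.edges) {v : Valuation X}
    {c : ℝ} (h : CPReach A M e.src v c) (hg : e.guard.Sat v) :
    CPReach A M e.tgt (v.reset e.reset) (c + A.edgeWeight e) := by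
  obtain ⟨W, hper, hi, hc, hp⟩ := h
  have hk : ∀ a b, IntervalIntegrable (fun _ => (A.edgeWeight e : ℝ)) MeasureTheory.volume a b :=
    fun a b => intervalIntegrable_const
  refine ⟨fun φ => W φ + A.edgeWeight e, fun φ => by simp [hper φ], fun a b => (hi a b).add (hk a b),
    ?_, fun φ => ?_⟩
  · rw [intervalIntegral.integral_add (hi 0 1) (hk 0 1)]
    simpa using hc
  · refine (hp φ).trans (.of_step (k := .discrete) (w := A.edgeWeight e)
      ⟨.edge (CPState.ofVal M e.src v φ) (CPState.ofVal M e.tgt (v.reset e.reset) φ) e he rfl rfl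
        (fun v' hv' a ha => RegionEquiv.holds hv' (hM e he a ha) (hg a ha))
        (fun v' hv' => RegionEquiv.reset hv' _) (fun x _ hx => ?_) fun x _ _ hx => ?_,
        fun h => by cases h⟩ le_rfl) le_rfl
    · change (phaseRound φ (v.reset e.reset x)).toNat = 0
      simp [Valuation.reset, hx, phaseRound_zero]
    · change (phaseRound φ (v.reset e.reset x)).toNat = (phaseRound φ (v x)).toNat
      simp [Valuation.reset, hx]

end Reach

/-! ### Zones and their closures -/

section Zones

variable {X : Type*}

/-- The non-strict version of `a ∼ b`. -/
def Cmp.WeakHolds : Cmp → ℝ → ℝ → Prop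
  | .lt, a, b => a ≤ b
  | .le, a, b => a ≤ b
  | .eq, a, b => a = b
  | .ge, a, b => b ≤ a
  | .gt, a, b => b ≤ a

theorem Cmp.Holds.weak {r : Cmp} {a b : ℝ} (h : r.Holds a b) : r.WeakHolds a b := by
  cases r <;> simp only [Cmp.Holds, Cmp.WeakHolds] at h ⊢ <;> linarith

theorem Cmp.WeakHolds.mix {r : Cmp} {p q k a b : ℝ} (hp : r.WeakHolds p k) (hq : r.Holds q k)
    (hab : a + b = 1) (ha : 0 ≤ a) (hb : 0 < b) : r.Holds (a * p + b * q) k := by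
  obtain rfl : a = 1 - b := by linarith
  cases r <;> simp only [Cmp.Holds, Cmp.WeakHolds] at hp hq ⊢
  · nlinarith
  · nlinarith
  · rw [hp, hq]; ring
  · nlinarith
  · nlinarith

theorem Cmp.isClosed_weakHolds (r : Cmp) (k : ℝ) : IsClosed {a | r.WeakHolds a k} := by
  cases r
  · exact isClosed_Iic
  · exact isClosed_Iic
  · exact isClosed_singleton
  · exact isClosed_Ici
  · exact isClosed_Ici

/-- The left-hand side of a constraint. -/
def ZoneAtom.lhs : ZoneAtom X → Valuation X → ℝ
  | .clock x _ _, v => v x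
  | .diff x y _ _, v => (v x : ℝ) - v y

/-- The comparison symbol of a constraint. -/
def ZoneAtom.rel : ZoneAtom X → Cmp
  | .clock _ r _ => r
  | .diff _ _ r _ => r

/-- The right-hand side of a constraint. -/
def ZoneAtom.rhs : ZoneAtom X → ℤ
  | .clock _ _ c => c
  | .diff _ _ _ c => c

theorem ZoneAtom.sat_iff (a : ZoneAtom X) (v : Valuation X) :
    a.Sat v ↔ a.rel.Holds (a.lhs v) a.rhs := by cases a <;> exact Iff.rfl

theorem ZoneAtom.lhs_mix (c : ZoneAtom X) (a b : ℝ≥0) (u z : Valuation X) :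
    c.lhs (a • u + b • z) = a * c.lhs u + b * c.lhs z := by
  cases c <;> simp [ZoneAtom.lhs]
  ring

theorem ZoneAtom.continuous_lhs (c : ZoneAtom X) : Continuous c.lhs := by
  cases c <;> unfold ZoneAtom.lhs <;> fun_prop

theorem ZoneAtom.weakHolds_of_mem_closure {c : ZoneAtom X} {Z : Set (Valuation X)}
    (hZ : ∀ v ∈ Z, c.Sat v) {u : Valuation X} (hu : u ∈ closure Z) :
    c.rel.WeakHolds (c.lhs u) c.rhs :=
  closure_minimal (fun v hv => ((c.sat_iff v).1 (hZ v hv)).weak)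
    ((c.rel.isClosed_weakHolds c.rhs).preimage c.continuous_lhs) hu

theorem mix_mem_zone {l : List (ZoneAtom X)} {u z : Valuation X}
    (hu : ∀ c ∈ l, c.rel.WeakHolds (c.lhs u) c.rhs) (hz : ∀ c ∈ l, c.Sat z) {a b : ℝ≥0}
    (hab : a + b = 1) (hb : 0 < b) : ∀ c ∈ l, c.Sat (a • u + b • z) := fun c hc => by
  rw [c.sat_iff, c.lhs_mix]
  exact (hu c hc).mix ((c.sat_iff z).1 (hz c hc)) (by exact_mod_cast hab) a.coe_nonneg
    (by exact_mod_cast hb)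

/-- At a point of the closure the constraints hold weakly; any positive share of a point of the zone
makes them strict where required. -/
theorem IsZone.mix_mem {Z : Set (Valuation X)} (hZ : IsZone Z) {u z : Valuation X}
    (hu : u ∈ closure Z) (hz : z ∈ Z) {a b : ℝ≥0} (hab : a + b = 1) (hb : 0 < b) :
    a • u + b • z ∈ Z := by
  obtain ⟨l, rfl⟩ := hZ
  exact mix_mem_zone
    (fun c hc => c.weakHolds_of_mem_closure (Z := {v | ∀ c ∈ l, c.Sat v}) (fun v hv => hv c hc) hu)
    hz hab hb

theorem IsZone.mix_mem_closure {Z : Set (Valuation X)} (hZ : IsZone Z) {u z : Valuation X}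
    (hu : u ∈ closure Z) (hz : z ∈ closure Z) {a b : ℝ≥0} (hab : a + b = 1) :
    a • u + b • z ∈ closure Z := by
  rcases eq_or_ne b 0 with rfl | hb
  · simp only [add_zero] at hab
    simpa [hab] using hu
  have hc : Continuous fun z : Valuation X => a • u + b • z := by fun_prop
  exact map_mem_closure (f := fun z : Valuation X => a • u + b • z) hc hz fun z hz => hZ.mix_mem hu hz hab (pos_iff_ne_zero.2 hb)

theorem isClosed_facet {Z : Set (Valuation X)} {f : Valuation X → ℝ} (hf : Continuous f) (n : ℤ) :
    IsClosed (facet Z f n) :=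
  isClosed_closure.inter (isClosed_eq hf continuous_const)

/-- The time elapsed since the facet is `v x - n`, so the point of the facet is a continuous
function of `v`. -/
theorem isClosed_future_facet (Z : Set (Valuation X)) (x : X) (n : ℤ) :
    IsClosed (future (facet Z (fun v => v x) n)) := by
  have hF := isClosed_facet (Z := Z) (f := fun v : Valuation X => (v x : ℝ)) (by fun_prop) n
  have hg : Continuous fun v : Valuation X => (fun y => v y - (v x - Real.toNNReal n)) := by
    refine continuous_pi fun y => ?_
    fun_prop
  -- Subtraction in `ℝ≥0` is truncated; adding the subtracted amount back and comparing with `v`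
  -- expresses that no truncation took place.
  have hd : Continuous fun v : Valuation X =>
      (fun y => v y - (v x - Real.toNNReal n) + (v x - Real.toNNReal n)) :=
    continuous_pi fun y => by fun_prop
  convert (hF.preimage hg).inter (isClosed_eq hd continuous_id) using 1
  ext v
  constructor
  · rintro ⟨f, hf, t, rfl⟩
    have hn : Real.toNNReal n = f x := by rw [← hf.2, Real.toNNReal_coe]
    have ht : f.delay t x - Real.toNNReal n = t := by simp [hn, Valuation.delay]
    refine ⟨?_, ?_⟩
    · rw [mem_preimage, ht]
      simpa [Valuation.delay] using hf
    · ext y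
      simp [hn, Valuation.delay]
  · rintro ⟨h1, h2⟩
    exact ⟨_, h1, v x - Real.toNNReal n, h2.symm⟩

theorem facet_mix {Z : Set (Valuation X)} (hZ : IsZone Z) {h : Valuation X → ℝ} {n : ℤ}
    (hh : ∀ (a b : ℝ≥0) u z, h (a • u + b • z) = a * h u + b * h z) {u z : Valuation X}
    (hu : u ∈ facet Z h n) (hz : z ∈ facet Z h n) {a b : ℝ≥0} (hab : a + b = 1) :
    a • u + b • z ∈ facet Z h n := by
  refine ⟨hZ.mix_mem_closure hu.1 hz.1 hab, ?_⟩
  rw [hh, hu.2, hz.2, ← add_mul]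
  have : (a : ℝ) + b = 1 := by exact_mod_cast hab
  rw [this, one_mul]

/-- A ray that meets a facet in an interior point of the ray lies in the facet. -/
theorem ray_subset_facet {Z : Set (Valuation X)} {h : Valuation X → ℝ} {n : ℤ}
    (hh : ∀ (a b : ℝ≥0) u z, h (a • u + b • z) = a * h u + b * h z)
    (ht : TightLower (closure Z) h n ∨ TightUpper (closure Z) h n) {u d : Valuation X} {δ : ℝ≥0}
    (hδ : 0 < δ) (hu : u + δ • d ∈ facet Z h n) (hray : ∀ D : ℝ≥0, u + D • d ∈ closure Z)
    (D : ℝ≥0) : u + D • d ∈ facet Z h n := by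
  have e : ∀ D : ℝ≥0, h (u + D • d) = h u + D * h d := fun D => by simpa using hh 1 D u d
  have h1 := hu.2
  rw [e] at h1
  have hδ' : (0 : ℝ) < δ := by exact_mod_cast hδ
  -- The value `n` is extremal and is attained strictly inside the ray, so `h` can neither increase
  -- nor decrease along it.
  have hd : h d = 0 := by
    rcases ht with ht | ht
    · have h2 := ht.1 _ (hray 0)
      have h3 := ht.1 _ (hray (δ + 1))
      rw [e] at h2 h3
      push_cast at h2 h3
      nlinarith
    · have h2 := ht.1 _ (hray 0)
      have h3 := ht.1 _ (hray (δ + 1))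
      rw [e] at h2 h3
      push_cast at h2 h3
      nlinarith
  refine ⟨hray D, ?_⟩
  rw [e, hd]
  rw [hd] at h1
  simpa using h1

end Zones

/-! ### Affine cost functions -/

section Cost

variable {X : Type*} [Fintype X] (ζ : CostFun X)

theorem CostFun.continuous_eval : Continuous ζ.eval := by
  unfold CostFun.eval
  fun_prop

theorem CostFun.eval_ray (u d : Valuation X) (D : ℝ≥0) :
    ζ.eval (u + D • d) = ζ.eval u + D * (ζ.eval (u + d) - ζ.eval u) := by
  have : ∀ D : ℝ≥0, ζ.eval (u + D • d) = ζ.eval u + D * ∑ x, ζ.coef x * d x := fun D => by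
    unfold CostFun.eval
    rw [add_right_comm, Finset.mul_sum, ← Finset.sum_add_distrib]
    congr 1
    refine Finset.sum_congr rfl fun x _ => ?_
    simp; ring
  have h1 := this 1
  rw [one_smul] at h1
  rw [this, h1]
  simp

theorem CostFun.eval_delay (v : Valuation X) (t : ℝ≥0) :
    ζ.eval (v.delay t) = ζ.eval v + ζ.slope * t := by
  simp only [CostFun.eval, CostFun.slope, Valuation.delay, NNReal.coe_add, mul_add,
    Finset.sum_add_distrib, Finset.sum_mul]
  ring

variable [DecidableEq X]

theorem sum_update_mul (c : X → ℝ) (x : X) (k : ℝ) (v : X → ℝ) :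
    ∑ y, Function.update c x k y * v y = ∑ y, c y * v y + (k - c x) * v x := by
  rw [← Finset.add_sum_erase _ _ (Finset.mem_univ x),
    ← Finset.add_sum_erase _ (fun y => c y * v y) (Finset.mem_univ x)]
  rw [Function.update_self, Finset.sum_congr rfl fun y hy => by
    rw [Function.update_of_ne (Finset.ne_of_mem_erase hy)]]
  ring

theorem CostFun.eval_afterDelay (w : ℝ) {x : X} {n : ℤ} {f : Valuation X} (hf : (f x : ℝ) = n)
    (t : ℝ≥0) : (ζ.afterDelay w x n).eval (f.delay t) = ζ.eval f + w * t := by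
  have h := ζ.eval_delay f t
  simp only [CostFun.eval, CostFun.afterDelay] at h ⊢
  rw [sum_update_mul]
  have : ((f.delay t x : ℝ≥0) : ℝ) = n + t := by simp [Valuation.delay, hf]
  rw [this]
  linarith

theorem CostFun.eval_reset (v : Valuation X) (y : X) :
    ∑ x, ζ.coef x * (v.reset {y} x : ℝ≥0) = ∑ x, ζ.coef x * v x - ζ.coef y * v y := by
  rw [← Finset.add_sum_erase _ _ (Finset.mem_univ y),
    ← Finset.add_sum_erase _ (fun x => ζ.coef x * (v x : ℝ)) (Finset.mem_univ y)]
  rw [Finset.sum_congr rfl fun x hx => by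
    rw [Valuation.reset, if_neg (by simpa using Finset.ne_of_mem_erase hx)]]
  simp [Valuation.reset]

theorem CostFun.eval_substConst {y : X} {n : ℤ} {u : Valuation X} (hu : (u y : ℝ) = n) :
    (ζ.substConst y n).eval (u.reset {y}) = ζ.eval u := by
  simp only [CostFun.eval, CostFun.substConst]
  rw [sum_update_mul, ζ.eval_reset]
  simp [Valuation.reset, hu]

theorem CostFun.eval_substClock {y x : X} (hx : x ≠ y) {m : ℤ} {u : Valuation X}
    (hu : (u y : ℝ) - u x = m) : (ζ.substClock y x m).eval (u.reset {y}) = ζ.eval u := by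
  simp only [CostFun.eval, CostFun.substClock]
  rw [sum_update_mul, sum_update_mul, ζ.eval_reset, ← hu]
  simp [Valuation.reset, hx]
  ring

end Cost

/-! ### Costs on priced zones and costs of runs -/

section Auxiliary

variable {X : Type*}

theorem exists_pos_forall_mul_lt (K : ℝ) {ε : ℝ} (hε : 0 < ε) :
    ∃ b₀ : ℝ≥0, 0 < b₀ ∧ ∀ b : ℝ≥0, b < b₀ → K * b < ε := by
  have hK : (0 : ℝ) < |K| + 1 := by positivity
  refine ⟨Real.toNNReal (ε / (|K| + 1)), Real.toNNReal_pos.2 (by positivity), fun b hb => ?_⟩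
  have h1 : (b : ℝ) < ε / (|K| + 1) := by
    have := NNReal.coe_lt_coe.2 hb
    rwa [Real.coe_toNNReal _ (by positivity)] at this
  rw [lt_div_iff₀ hK] at h1
  have h2 := le_abs_self K
  have h3 := b.coe_nonneg
  nlinarith

theorem isClosed_leBound (m : WithBot ℕ) : IsClosed {a | LeBound m a} := by
  induction m with
  | bot =>
    convert isClosed_empty
    ext a
    simp [LeBound]
  | coe k =>
    convert isClosed_Iic (a := (k : ℝ≥0))
    ext a
    constructor
    · rintro ⟨k', hk, ha⟩
      have : k = k' := WithBot.coe_injective hk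
      subst this
      exact ha
    · exact fun h => ⟨k, rfl, h⟩

theorem delay_mix (a b t s : ℝ≥0) (u z : Valuation X) :
    a • u.delay t + b • z.delay s = (a • u + b • z).delay (a * t + b * s) := by
  ext x
  simp [Valuation.delay]
  ring

theorem reset_mix [DecidableEq X] (Y : Finset X) (a b : ℝ≥0) (u z : Valuation X) :
    (a • u + b • z).reset Y = a • u.reset Y + b • z.reset Y := by
  ext x
  by_cases hx : x ∈ Y <;> simp [Valuation.reset, hx]

/-- If the zone is not closed, the facet may lie outside it and `f.delay t` outside `Z'`. Mixing
with a point of `Z'` moves both witnesses, the one in `Z` and the one in the facet, to admissible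
places. -/
theorem delay_mem_closure {Z Z' : Set (Valuation X)} (hZ : IsZone Z) {x : X} {n : ℤ}
    (hZ' : Z' = future Z ∩ future (facet Z (fun v => v x) n)) (hne : Z'.Nonempty) {f : Valuation X}
    (hf : f ∈ facet Z (fun v => v x) n) (t : ℝ≥0) : f.delay t ∈ closure Z' := by
  obtain ⟨z', hz'⟩ := hne
  refine mem_closure_of_mix (z := z') fun a b hab hb => ?_
  rw [hZ'] at hz' ⊢
  obtain ⟨⟨z, hz, s, hs⟩, ⟨f₀, hf₀, r, hr⟩⟩ := hz'
  refine ⟨⟨a • f + b • z, hZ.mix_mem hf.1 hz hab hb, a * t + b * s, ?_⟩,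
    ⟨a • f + b • f₀, facet_mix hZ (fun a b u z => coe_mix a b u z x) hf hf₀ hab, a * t + b * r, ?_⟩⟩
  · rw [hs, delay_mix]
  · rw [hr, delay_mix]

end Auxiliary

/-! ### The invariant of the forward exploration: good and bad points of priced zones -/

section Invariant

variable {X : Type*} [Fintype X]

/-- Points near `u` on all segments from `u` into the zone have a cost of almost `ζ(u)` in `C`. -/
def GoodAt (C : Valuation X → ℝ → Prop) (P : PricedZone X) (u : Valuation X) : Prop :=
  ∀ z ∈ P.zone, ∀ ε : ℝ, 0 < ε → ∃ b₀ : ℝ≥0, 0 < b₀ ∧ ∀ a b : ℝ≥0, a + b = 1 → 0 < b → b < b₀ →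
    ∃ c < P.cost.eval u + ε, C (a • u + b • z) c

/-- The point `u` lies inside a ray of the closure of the zone along which the cost decreases; the
clocks that vary on the ray are unbounded. -/
def BadAt (M : X → WithBot ℕ) (P : PricedZone X) (u : Valuation X) : Prop :=
  ∃ (u' d : Valuation X) (δ : ℝ≥0), 0 < δ ∧ u = u' + δ • d ∧
    (∀ x, d x ≠ 0 → ¬ LeBound (M x) (u' x)) ∧ (∀ D : ℝ≥0, u' + D • d ∈ closure P.zone) ∧
    P.cost.eval (u' + d) < P.cost.eval u'

/-- The points of the closure of the zone are good or bad. -/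
def Traced (M : X → WithBot ℕ) (C : Valuation X → ℝ → Prop) (P : PricedZone X) : Prop :=
  ∀ u ∈ closure P.zone, GoodAt C P u ∨ BadAt M P u

variable {M : X → WithBot ℕ} {C C' : Valuation X → ℝ → Prop} {P P' : PricedZone X}

theorem Traced.mono (h : Traced M C P) (hC : ∀ v c, C v c → C' v c) : Traced M C' P :=
  fun u hu => (h u hu).imp_left fun hg z hz ε hε =>
    let ⟨b₀, hb₀, hb⟩ := hg z hz ε hε
    ⟨b₀, hb₀, fun a b hab h0 h1 => let ⟨c, hc, hc'⟩ := hb a b hab h0 h1; ⟨c, hc, hC _ _ hc'⟩⟩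

/-- The cost is affine, so along a decreasing ray it tends to `-∞`; by continuity a lower bound on
the zone also holds on its closure. -/
theorem PricedZone.LowerBounded.not_badAt (h : P.LowerBounded) (u : Valuation X) :
    ¬ BadAt M P u := by
  rintro ⟨u', d, δ, -, -, -, hray, hlt⟩
  obtain ⟨m, hm⟩ := h
  have hcl : ∀ v ∈ closure P.zone, m ≤ P.cost.eval v := fun v hv =>
    closure_minimal (fun z hz => hm ⟨z, hz, rfl⟩)
      (isClosed_le continuous_const P.cost.continuous_eval) hv
  have hpos : 0 < P.cost.eval u' - P.cost.eval (u' + d) := by linarith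
  obtain ⟨N, hN⟩ := exists_nat_gt ((P.cost.eval u' - m) / (P.cost.eval u' - P.cost.eval (u' + d)))
  have h1 := hcl _ (hray N)
  rw [P.cost.eval_ray] at h1
  rw [div_lt_iff₀ hpos] at hN
  push_cast at h1
  nlinarith

theorem Traced.guard {g : Guard X} (hg : ∀ a ∈ g, (a.const : WithBot ℕ) ≤ M a.clock)
    (hz : P'.zone = {v ∈ P.zone | g.Sat v}) (hc : P'.cost = P.cost) (h : Traced M C P) :
    Traced M (fun v c => C v c ∧ g.Sat v) P' := by
  have hweak : ∀ u ∈ closure P'.zone, ∀ a ∈ g, a.rel.WeakHolds (u a.clock) a.const :=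
    fun u hu a ha => closure_minimal (fun v hv => by
        rw [hz] at hv
        exact (hv.2 a ha).weak)
      ((a.rel.isClosed_weakHolds a.const).preimage
        (f := fun v : Valuation X => (v a.clock : ℝ)) (by fun_prop)) hu
  have hmix : ∀ u z : Valuation X, (∀ a ∈ g, a.rel.WeakHolds (u a.clock) a.const) → g.Sat z →
      ∀ a b : ℝ≥0, a + b = 1 → 0 < b → g.Sat (a • u + b • z) := by
    intro u z hu hz a b hab hb c hc
    rw [coe_mix]
    exact (hu c hc).mix (hz c hc) (by exact_mod_cast hab) a.coe_nonneg (by exact_mod_cast hb)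
  intro u hu
  obtain ⟨z₀, hz₀⟩ : P'.zone.Nonempty := closure_nonempty_iff.1 ⟨u, hu⟩
  have huP : u ∈ closure P.zone := closure_mono (by rw [hz]; exact sep_subset _ _) hu
  rcases h u huP with hgood | ⟨u', d, δ, hδ, hud, hub, hray, hlt⟩
  · left
    intro z hz' ε hε
    rw [hz] at hz'
    obtain ⟨b₀, hb₀, hb⟩ := hgood z hz'.1 ε hε
    refine ⟨b₀, hb₀, fun a b hab h0 h1 => ?_⟩
    obtain ⟨c, hc', hC⟩ := hb a b hab h0 h1
    exact ⟨c, by rwa [hc], hC, hmix u z (hweak u hu) hz'.2 a b hab h0⟩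
  · right
    refine ⟨u', d, δ, hδ, hud, hub, fun D => ?_, by rwa [hc]⟩
    -- A clock that varies along the ray exceeds the constants of the guard already at `u'`, and
    -- strictly more so at `u`. The constraints on it that hold weakly at `u` are thus lower bounds,
    -- which hold on the whole ray.
    have hw : ∀ a ∈ g, a.rel.WeakHolds ((u' + D • d) a.clock : ℝ≥0) a.const := by
      intro a ha
      have h1 := hweak u hu a ha
      rw [hud] at h1
      by_cases hd : d a.clock = 0
      · simpa [hd] using h1
      · have h2 := not_leBound_lt (hg a ha) (hub _ hd)
        have h3 : (0 : ℝ) < δ * d a.clock := by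
          have h4 : (0 : ℝ) < δ := by exact_mod_cast hδ
          have h5 : (0 : ℝ) < d a.clock := by exact_mod_cast pos_iff_ne_zero.2 hd
          positivity
        have h6 : (0 : ℝ) ≤ D * d a.clock := by positivity
        have e1 : (((u' + δ • d) a.clock : ℝ≥0) : ℝ) = u' a.clock + δ * d a.clock := by simp
        have e2 : (((u' + D • d) a.clock : ℝ≥0) : ℝ) = u' a.clock + D * d a.clock := by simp
        rw [e1] at h1
        rw [e2]
        cases hr : a.rel <;> rw [hr] at h1 <;> simp only [Cmp.WeakHolds] at h1 ⊢ <;> linarith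
    refine mem_closure_of_mix (z := z₀) fun a b hab hb => ?_
    rw [hz] at hz₀ ⊢
    exact ⟨P.isZone.mix_mem (hray D) hz₀.1 hab hb, hmix _ _ hw hz₀.2 a b hab hb⟩

variable [DecidableEq X] {L : Type*} {A : WTA X L}

/-- A point of the new closure is `f.delay t` with `f` in the facet, and its cost is that of `f`
plus `t` at the given rate. A bad `f` makes it bad, as the whole ray lies in the facet. A good `f`
makes it good, unless waiting at a negative rate lasts until all clocks are unbounded; then further
waiting decreases the cost and supplies a ray. -/
theorem Traced.delay_facet {l : L} {x : X} {n : ℤ}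
    (ht : TightLower (closure P.zone) (fun v => v x) n ∨
      TightUpper (closure P.zone) (fun v => v x) n)
    (hz : P'.zone = future P.zone ∩ future (facet P.zone (fun v => v x) n))
    (hc : P'.cost = P.cost.afterDelay (A.locWeight l) x n) (h : Traced M (CPReach A M l) P) :
    Traced M (CPReach A M l) P' := by
  intro v hv
  have hne : P'.zone.Nonempty := closure_nonempty_iff.1 ⟨v, hv⟩
  have hvF : v ∈ future (facet P.zone (fun v => v x) n) :=
    closure_minimal (by rw [hz]; exact inter_subset_right) (isClosed_future_facet _ _ _) hv
  obtain ⟨f, hf, t, rfl⟩ := hvF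
  have hcost : ∀ g ∈ facet P.zone (fun v => (v x : ℝ)) n, ∀ t : ℝ≥0,
      P'.cost.eval (g.delay t) = P.cost.eval g + A.locWeight l * t := fun g hg t => by
    rw [hc, P.cost.eval_afterDelay _ hg.2]
  rcases h f hf.1 with hg | ⟨f', d, δ, hδ, hfd, hub, hray, hlt⟩
  · by_cases hbad : (A.locWeight l < 0 ∧ ∀ y, ¬ LeBound (M y) (f.delay t y)) ∧ 0 < t
    · right
      obtain ⟨⟨hw, hub⟩, ht0⟩ := hbad
      -- Exceeding the bounds is an open condition, so it already holds shortly before `t`. The ray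
      -- starts there, which puts the given point in its interior.
      have hev : ∀ᶠ δ : ℝ≥0 in 𝓝[>] 0, δ ∈ Ioi 0 ∧ δ < t ∧
          ∀ y, ¬ LeBound (M y) (f y + (t - δ)) := by
        refine Filter.Eventually.and self_mem_nhdsWithin
          (nhdsWithin_le_nhds (Filter.Eventually.and (Iio_mem_nhds ht0)
            (eventually_all.2 fun y => ?_)))
        have hcont : Continuous fun δ : ℝ≥0 => f y + (t - δ) := by fun_prop
        refine hcont.continuousAt.eventually ((isClosed_leBound (M y)).isOpen_compl.mem_nhds ?_)
        simpa [Valuation.delay] using hub y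
      obtain ⟨δ, hδ, hδt, hδu⟩ := hev.exists
      have e : ∀ D : ℝ≥0, f.delay (t - δ) + D • (fun _ => 1) = f.delay (t - δ + D) := fun D => by
        ext y; simp [Valuation.delay, add_assoc]
      refine ⟨f.delay (t - δ), fun _ => 1, δ, hδ, ?_, fun y _ => hδu y, fun D => ?_, ?_⟩
      · rw [e, tsub_add_cancel_of_le hδt.le]
      · rw [e]; exact delay_mem_closure P.isZone hz hne hf _
      · have := e 1
        rw [one_smul] at this
        rw [this, hcost f hf, hcost f hf]
        have hw' : (A.locWeight l : ℝ) < 0 := by exact_mod_cast hw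
        push_cast
        nlinarith
    · left
      intro z' hz' ε hε
      rw [hz] at hz'
      obtain ⟨⟨z, hzz, s, rfl⟩, -⟩ := hz'
      obtain ⟨b₁, hb₁, hg⟩ := hg z hzz (ε / 2) (half_pos hε)
      rw [hcost f hf]
      rcases le_or_gt 0 (A.locWeight l) with hw | hw
      · obtain ⟨b₂, hb₂, hK⟩ := exists_pos_forall_mul_lt (A.locWeight l * s) (half_pos hε)
        refine ⟨min b₁ b₂, lt_min hb₁ hb₂, fun a b hab hb hbb => ?_⟩
        obtain ⟨c, hc, hr⟩ := hg a b hab hb (hbb.trans_le (min_le_left _ _))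
        rw [delay_mix]
        refine ⟨_, ?_, hr.delay (a * t + b * s) le_rfl (.inl hw)⟩
        have h1 := hK b (hbb.trans_le (min_le_right _ _))
        have h2 : (a : ℝ) ≤ 1 := by exact_mod_cast hab ▸ le_self_add
        have h3 : (0 : ℝ) ≤ A.locWeight l * t := by
          have : (0 : ℝ) ≤ A.locWeight l := by exact_mod_cast hw
          positivity
        push_cast
        nlinarith
      · -- the time that is spent at a negative rate before all clocks are unbounded
        have hT : ∃ K : ℝ, ∀ a b : ℝ≥0, a + b = 1 → ∃ T₁ ≤ a * t + b * s,
            (t : ℝ) - K * b ≤ T₁ ∧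
              (T₁ = 0 ∨ ∃ y, LeBound (M y) ((a • f + b • z) y + T₁)) := by
          by_cases hub : ∃ y, LeBound (M y) (f.delay t y)
          · obtain ⟨y, k, hk, hy⟩ := hub
            refine ⟨t + z y, fun a b hab => ⟨min (a * t + b * s) (k - (a • f + b • z) y),
              min_le_left _ _, ?_, ?_⟩⟩
            · have hab' : (a : ℝ) = 1 - b := by
                have : (a : ℝ) + b = 1 := by exact_mod_cast hab
                linarith
              have hy' : (f y : ℝ) + t ≤ k := by exact_mod_cast hy
              have hb := b.coe_nonneg
              have hz0 := (z y).coe_nonneg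
              have ht0 := t.coe_nonneg
              have hs0 := s.coe_nonneg
              have hb1 : (b : ℝ) ≤ 1 := by exact_mod_cast hab ▸ le_add_self
              rw [NNReal.coe_min]
              refine le_min ?_ ?_
              · push_cast
                rw [hab']
                nlinarith [mul_nonneg hb hz0, mul_nonneg hb hs0]
              · rw [NNReal.coe_sub_def, coe_mix, hab']
                refine le_trans ?_ (le_max_left _ _)
                push_cast
                nlinarith [mul_nonneg hb ht0, mul_nonneg hb (f y).coe_nonneg]
            · rcases le_total ((a • f + b • z) y) k with hle | hle
              · refine .inr ⟨y, k, hk, ?_⟩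
                calc (a • f + b • z) y + min (a * t + b * s) (k - (a • f + b • z) y)
                    ≤ (a • f + b • z) y + (k - (a • f + b • z) y) := by
                      gcongr; exact min_le_right _ _
                  _ = k := add_tsub_cancel_of_le hle
              · left
                rw [tsub_eq_zero_of_le hle]
                exact min_eq_right zero_le
          · have ht0 : t = 0 := by
              by_contra h0
              exact hbad ⟨⟨hw, not_exists.1 hub⟩, pos_iff_ne_zero.2 h0⟩
            exact ⟨0, fun a b _ => ⟨0, zero_le, by simp [ht0], .inl rfl⟩⟩
        obtain ⟨K, hT⟩ := hT
        obtain ⟨b₂, hb₂, hK⟩ := exists_pos_forall_mul_lt (-A.locWeight l * K) (half_pos hε)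
        refine ⟨min b₁ b₂, lt_min hb₁ hb₂, fun a b hab hb hbb => ?_⟩
        obtain ⟨c, hc, hr⟩ := hg a b hab hb (hbb.trans_le (min_le_left _ _))
        obtain ⟨T₁, hT₁, hT₂, hT₃⟩ := hT a b hab
        have hr' : CPReach A M l ((a • f + b • z).delay T₁) (c + A.locWeight l * T₁) := by
          rcases hT₃ with rfl | hy
          · rw [delay_zero]; simpa using hr
          · exact hr.delay T₁ le_rfl (.inr hy)
        -- The remaining time is charged `0`, which is at least the negative rate. The loss is
        -- proportional to `b` and is absorbed by `ε / 2`.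
        have hr'' := hr'.delay (a * t + b * s - T₁) (e := 0) hw.le (.inl le_rfl)
        rw [delay_delay, add_tsub_cancel_of_le hT₁] at hr''
        rw [delay_mix]
        refine ⟨_, ?_, hr''⟩
        have h1 := hK b (hbb.trans_le (min_le_right _ _))
        have hw' : (A.locWeight l : ℝ) < 0 := by exact_mod_cast hw
        push_cast
        nlinarith
  · right
    have hf' : ∀ D : ℝ≥0, f' + D • d ∈ facet P.zone (fun v => (v x : ℝ)) n := by
      subst hfd
      exact ray_subset_facet (fun a b u z => coe_mix a b u z x) ht hδ hf hray
    have e : ∀ D : ℝ≥0, f'.delay t + D • d = (f' + D • d).delay t := fun D => by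
      ext y; simp [Valuation.delay, add_right_comm]
    refine ⟨f'.delay t, d, δ, hδ, by rw [e, hfd], fun y hy => ?_, fun D => ?_, ?_⟩
    · exact fun hb => hub y hy (hb.mono le_self_add)
    · rw [e]; exact delay_mem_closure P.isZone hz hne (hf' D) t
    · have h1 := e 1
      have h2 := hf' 1
      have h3 := hf' 0
      rw [one_smul] at h1 h2
      rw [zero_smul, add_zero] at h3
      rw [h1, hcost _ h2, hcost _ h3]
      linarith

theorem Traced.delayPost {l : L} (h : Traced M (CPReach A M l) P)
    (hd : DelayPost (A.locWeight l) P P') : Traced M (CPReach A M l) P' := by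
  rcases hd with ⟨-, rfl⟩ | ⟨x, n, -, ht, hz, hc⟩ | ⟨x, n, -, ht, hz, hc⟩
  · exact h
  · exact h.delay_facet (.inr ht) hz hc
  · exact h.delay_facet (.inl ht) hz hc

/-- On the facet the value of `y` is a function `g` of the other clocks, so no information is lost
by the reset: points, costs and rays can be moved between the facet and its image. One statement
covers facets of clocks and of differences. -/
theorem Traced.reset_facet {y : X} {h : Valuation X → ℝ} {n : ℤ} (hcont : Continuous h)
    (hh : ∀ (a b : ℝ≥0) u z, h (a • u + b • z) = a * h u + b * h z)
    (ht : TightLower (closure P.zone) h n ∨ TightUpper (closure P.zone) h n)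
    (hz : P'.zone = resetAlong P.zone (facet P.zone h n) y)
    (hc : ∀ u ∈ facet P.zone h n, P'.cost.eval (u.reset {y}) = P.cost.eval u)
    {g : Valuation X → ℝ≥0} (hg : Continuous g)
    (hgy : ∀ u ∈ facet P.zone h n, u y = g (u.reset {y})) (hT : Traced M C P) :
    Traced M (fun v' c => ∃ v, C v c ∧ v' = v.reset {y}) P' := by
  intro v' hv'
  obtain ⟨z₀', hz₀'⟩ : P'.zone.Nonempty := closure_nonempty_iff.1 ⟨v', hv'⟩
  have hfac : ∀ f ∈ facet P.zone h n, f.reset {y} ∈ closure P'.zone := by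
    intro f hf
    refine mem_closure_of_mix (z := z₀') fun a b hab hb => ?_
    rw [hz] at hz₀' ⊢
    obtain ⟨z, hz, ⟨u₀, hu₀, hz'⟩, rfl⟩ := hz₀'
    refine ⟨a • f + b • z, P.isZone.mix_mem hf.1 hz hab hb,
      ⟨a • f + b • u₀, facet_mix P.isZone hh hf hu₀ hab, fun x hx => ?_⟩, (reset_mix _ _ _ _ _).symm⟩
    simp [hz' x hx]
  -- Restoring `y` by means of `g` is continuous, so the image of the facet is closed and contains
  -- the closure of the new zone.
  obtain ⟨u, hu, rfl⟩ : ∃ u ∈ facet P.zone h n, v' = u.reset {y} := by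
    have hcl : IsClosed {v' : Valuation X |
        Function.update v' y (g v') ∈ facet P.zone h n ∧ v' y = 0} :=
      ((isClosed_facet hcont n).preimage (f := fun v' : Valuation X => Function.update v' y (g v'))
        (continuous_id.update y hg)).inter (isClosed_eq (by fun_prop) continuous_const)
    have hsub : P'.zone ⊆ {v' : Valuation X |
        Function.update v' y (g v') ∈ facet P.zone h n ∧ v' y = 0} := by
      rw [hz]
      rintro _ ⟨v, -, ⟨u, hu, huv⟩, rfl⟩
      have hr : v.reset {y} = u.reset {y} := by
        ext x
        by_cases hx : x = y
        · simp [Valuation.reset, hx]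
        · simp [Valuation.reset, hx, huv x hx]
      have : Function.update (v.reset {y}) y (g (v.reset {y})) = u := by
        ext x
        by_cases hx : x = y
        · subst hx
          rw [Function.update_self, hr, hgy u hu]
        · rw [Function.update_of_ne hx, hr]
          simp [Valuation.reset, hx]
      exact ⟨by rwa [this], by simp [Valuation.reset]⟩
    obtain ⟨h1, h2⟩ := closure_minimal hsub hcl hv'
    refine ⟨_, h1, ?_⟩
    ext x
    by_cases hx : x = y
    · subst hx
      simp [Valuation.reset, h2]
    · simp [Valuation.reset, hx]
  rcases hT u hu.1 with hgood | ⟨u', d, δ, hδ, hud, hub, hray, hlt⟩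
  · left
    intro z' hz' ε hε
    rw [hz] at hz'
    obtain ⟨z, hz, -, rfl⟩ := hz'
    obtain ⟨b₀, hb₀, hb⟩ := hgood z hz ε hε
    refine ⟨b₀, hb₀, fun a b hab h0 h1 => ?_⟩
    obtain ⟨c, hc', hC⟩ := hb a b hab h0 h1
    exact ⟨c, by rwa [hc u hu], _, hC, (reset_mix _ _ _ _ _).symm⟩
  · right
    have hF : ∀ D : ℝ≥0, u' + D • d ∈ facet P.zone h n := by
      subst hud
      exact ray_subset_facet hh ht hδ hu hray
    have e : ∀ D : ℝ≥0, u'.reset {y} + D • d.reset {y} = (u' + D • d).reset {y} := fun D => by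
      simpa using (reset_mix {y} 1 D u' d).symm
    refine ⟨u'.reset {y}, d.reset {y}, δ, hδ, by rw [e, hud], fun x hx => ?_, fun D => ?_, ?_⟩
    · by_cases hxy : x = y
      · simp [Valuation.reset, hxy] at hx
      · simp only [Valuation.reset, Finset.mem_singleton, hxy, if_false] at hx ⊢
        exact hub x hx
    · rw [e]; exact hfac _ (hF D)
    · have h1 := e 1
      have h2 := hF 1
      have h3 := hF 0
      rw [one_smul, one_smul] at h1
      rw [one_smul] at h2
      rw [zero_smul, add_zero] at h3
      rwa [h1, hc _ h2, hc _ h3]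

theorem Traced.reset_clock {y : X} {n : ℤ}
    (ht : TightLower (closure P.zone) (fun v => v y) n ∨
      TightUpper (closure P.zone) (fun v => v y) n)
    (hz : P'.zone = resetAlong P.zone (facet P.zone (fun v => v y) n) y)
    (hc : P'.cost = P.cost.substConst y n) (hT : Traced M C P) :
    Traced M (fun v' c => ∃ v, C v c ∧ v' = v.reset {y}) P' :=
  hT.reset_facet (by fun_prop) (fun a b u z => coe_mix a b u z y) ht hz
    (fun u hu => by rw [hc, P.cost.eval_substConst hu.2]) (g := fun _ => Real.toNNReal n)
    continuous_const fun u hu => by rw [← hu.2, Real.toNNReal_coe]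

theorem Traced.reset_diff {x y : X} {m : ℤ} (hx : x ≠ y)
    (ht : TightLower (closure P.zone) (fun v => (v y : ℝ) - v x) m ∨
      TightUpper (closure P.zone) (fun v => (v y : ℝ) - v x) m)
    (hz : P'.zone = resetAlong P.zone (facet P.zone (fun v => (v y : ℝ) - v x) m) y)
    (hc : P'.cost = P.cost.substClock y x m) (hT : Traced M C P) :
    Traced M (fun v' c => ∃ v, C v c ∧ v' = v.reset {y}) P' :=
  hT.reset_facet (by fun_prop) (fun a b u z => by rw [coe_mix, coe_mix]; ring) ht hz
    (fun u hu => by rw [hc, P.cost.eval_substClock hx hu.2])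
    (g := fun v => Real.toNNReal (v x + m)) (by fun_prop) fun u hu => by
      have : (u x + m : ℝ) = u y := by
        have := hu.2
        dsimp only at this
        linarith
      simp [Valuation.reset, hx, this]

theorem Traced.resetPost {y : X} (h : ResetPost y P P') (hT : Traced M C P) :
    Traced M (fun v' c => ∃ v, C v c ∧ v' = v.reset {y}) P' := by
  cases h with
  | lowerClock n _ ht hz hc => exact hT.reset_clock (.inl ht) hz hc
  | lowerDiff x m hx _ ht hz hc => exact hT.reset_diff hx (.inl ht) hz hc
  | upperClock n _ ht hz hc => exact hT.reset_clock (.inr ht) hz hc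
  | upperDiff x m hx _ ht hz hc => exact hT.reset_diff hx (.inr ht) hz hc

theorem Traced.resetListPost {l : List X} (h : ResetListPost l P P') (hT : Traced M C P) :
    Traced M (fun v' c => ∃ v, C v c ∧ v' = v.reset l.toFinset) P' := by
  induction l generalizing P C with
  | nil =>
    obtain rfl : P' = P := h
    exact hT.mono fun v c hC => ⟨v, hC, by ext; simp [Valuation.reset]⟩
  | cons y l ih =>
    obtain ⟨Q, hQ, hl⟩ := h
    refine (ih hl (hT.resetPost hQ)).mono ?_
    rintro _ c ⟨_, ⟨v, hC, rfl⟩, rfl⟩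
    refine ⟨v, hC, ?_⟩
    ext x
    by_cases h1 : x = y <;> by_cases h2 : x ∈ l <;> simp [Valuation.reset, h1, h2]

theorem Traced.edgePost (hM : IsMaxConst A M) {e : Edge X L} (he : e ∈ A.edges)
    (h : EdgePost e (A.edgeWeight e) P P') (hT : Traced M (CPReach A M e.src) P) :
    Traced M (CPReach A M e.tgt) P' := by
  obtain ⟨Q, R, l, hQz, hQc, -, hl, hR, hz, hc⟩ := h
  have hTR := (hT.guard (hM e he) hQz hQc).resetListPost hR
  have heval : ∀ v, P'.cost.eval v = R.cost.eval v + A.edgeWeight e := fun v => by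
    rw [hc, CostFun.eval, CostFun.eval, CostFun.addConst, add_assoc]
  intro u hu
  rw [hz] at hu
  rcases hTR u hu with hg | ⟨u', d, δ, hδ, hud, hub, hray, hlt⟩
  · left
    intro z hz' ε hε
    rw [hz] at hz'
    obtain ⟨b₀, hb₀, hb⟩ := hg z hz' ε hε
    refine ⟨b₀, hb₀, fun a b hab h0 h1 => ?_⟩
    obtain ⟨c, hc', v, ⟨hC, hgs⟩, hv⟩ := hb a b hab h0 h1
    refine ⟨c + A.edgeWeight e, by rw [heval]; linarith, ?_⟩
    rw [hv, hl]
    exact hC.edge hM he hgs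
  · right
    exact ⟨u', d, δ, hδ, hud, hub, by rwa [hz], by rw [heval, heval]; linarith⟩

theorem traced_initial : Traced M (CPReach A M A.init) (PricedZone.initial X) := by
  intro u hu
  have h0 : closure (PricedZone.initial X).zone = {fun _ => 0} := isClosed_singleton.closure_eq
  rw [h0] at hu
  obtain rfl : u = fun _ => 0 := hu
  left
  intro z hz ε hε
  obtain rfl : z = fun _ => 0 := hz
  refine ⟨1, one_pos, fun a b _ _ _ => ⟨0, ?_, ?_⟩⟩
  · simpa [CostFun.eval, PricedZone.initial] using hε
  · have : a • (fun _ => 0 : Valuation X) + b • (fun _ => 0 : Valuation X) = fun _ => 0 := by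
      ext; simp
    rw [this]
    exact cpReach_initial

theorem traced_of_reflTransGen (hM : IsMaxConst A M) {s : L × PricedZone X}
    (h : Relation.ReflTransGen (Post A) (A.init, PricedZone.initial X) s) :
    Traced M (CPReach A M s.1) s.2 := by
  induction h with
  | refl => exact traced_initial
  | tail _ hp ih =>
    obtain ⟨e, he, hs, ht, Q, hd, hP⟩ := hp
    have h1 := ih.delayPost hd
    rw [← hs] at h1
    rw [← ht]
    exact h1.edgePost hM he hP

theorem Explored.traced (hM : IsMaxConst A M) {s : L × PricedZone X} (h : Explored A s) :
    Traced M (CPReach A M s.1) s.2 := by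
  obtain ⟨s₀, h₀, rfl | ⟨hl, hd⟩⟩ := h
  · exact traced_of_reflTransGen hM h₀
  · rw [hl]
    exact (traced_of_reflTransGen hM h₀).delayPost hd

/-- The costs of priced zones that are bounded from below are bounded by weights of paths of the
corner-point abstraction. -/
theorem Explored.exists_frugalReach (hM : IsMaxConst A M) {s : L × PricedZone X}
    (h : Explored A s) (hb : s.2.LowerBounded) {u : Valuation X} (hu : u ∈ closure s.2.zone) :
    ∃ s', FrugalReach A M (CPState.initial A M) s' (s.2.cost.eval u + 1) := by
  have hg := (h.traced hM u hu).resolve_right (hb.not_badAt u)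
  obtain ⟨z, hz⟩ : s.2.zone.Nonempty := closure_nonempty_iff.1 ⟨u, hu⟩
  -- The point `u` need not lie in the zone, so its cost is only approximated from a segment; the
  -- error `1` is good enough for a uniform bound.
  obtain ⟨b₀, hb₀, hg⟩ := hg z hz 1 one_pos
  obtain ⟨b, hb, hb'⟩ := exists_between (lt_min hb₀ one_pos)
  obtain ⟨c, hc, hr⟩ := hg (1 - b) b (tsub_add_cancel_of_le (hb'.le.trans (min_le_right _ _))) hb
    (hb'.trans_le (min_le_left _ _))
  obtain ⟨s', hs'⟩ := hr.exists_path
  exact ⟨s', hs'.mono hc.le⟩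

end Invariant

/-! ### Finiteness of the corner-point abstraction -/

section Finite

variable {X L : Type*} {M : X → WithBot ℕ}

theorem exists_bound_maxConst [Finite X] (M : X → WithBot ℕ) :
    ∃ N : ℕ, ∀ x, ∀ k : ℕ, M x = k → k ≤ N := by
  obtain ⟨N, hN⟩ := (Set.finite_range fun x => (M x).unbotD 0).bddAbove
  exact ⟨N, fun x k hk => by simpa [hk] using hN ⟨x, rfl⟩⟩

theorem finite_regions [Finite X] (M : X → WithBot ℕ) :
    Finite {R : Set (Valuation X) // IsRegion M R} := by
  classical
  obtain ⟨N, hN⟩ := exists_bound_maxConst M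
  -- A region is determined by finitely many data. Integral parts matter only for bounded clocks,
  -- where they are at most `N`, so they can be capped there.
  let D : Valuation X → (X → Prop) × (X → Fin (N + 1)) × (X → Prop) × (X → X → Prop) := fun v =>
    (fun x => LeBound (M x) (v x), fun x => ⟨min ⌊v x⌋₊ N, by omega⟩,
      fun x => Int.fract (v x : ℝ) = 0, fun x y => Int.fract (v x : ℝ) ≤ Int.fract (v y : ℝ))
  have hD : ∀ v v', D v = D v' → RegionEquiv M v v' := by
    intro v v' h
    simp only [D, Prod.mk.injEq, funext_iff, eq_iff_iff, Fin.mk.injEq] at h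
    obtain ⟨h1, h2, h3, h4⟩ := h
    have hfl : ∀ v : Valuation X, ∀ x, LeBound (M x) (v x) → ⌊v x⌋₊ ≤ N := by
      rintro v x ⟨k, hk, hx⟩
      exact (Nat.floor_le_of_le hx).trans (hN x k hk)
    refine ⟨h1, fun x hx => ⟨?_, h3 x⟩, fun x y _ _ => h4 x y⟩
    have := h2 x
    rwa [min_eq_left (hfl v x hx), min_eq_left (hfl v' x ((h1 x).1 hx))] at this
  choose r hr using fun R : {R : Set (Valuation X) // IsRegion M R} => R.2
  refine Finite.of_injective (fun R => D (r R)) fun R R' h => Subtype.ext ?_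
  rw [hr R, hr R']
  exact regionOf_eq_of_equiv (hD _ _ h)

theorem CPState.corner_le (s : CPState L M) {x : X} (hx : x ∈ boundedClocks M s.region) {N : ℕ}
    (hN : ∀ x, ∀ k : ℕ, M x = k → k ≤ N) : s.corner ⟨x, hx⟩ ≤ N := by
  have hcl : IsClosed {w : boundedClocks M s.region → ℝ≥0 | w ⟨x, hx⟩ ≤ N} :=
    isClosed_le (by fun_prop) continuous_const
  have hsub : proj (boundedClocks M s.region) '' s.region ⊆ {w | w ⟨x, hx⟩ ≤ N} := by
    rintro _ ⟨v, hv, rfl⟩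
    obtain ⟨k, hk, hvk⟩ := hx v hv
    exact hvk.trans (by exact_mod_cast hN x k hk)
  have : ((s.corner ⟨x, hx⟩ : ℕ) : ℝ≥0) ≤ N := closure_minimal hsub hcl s.isCorner
  exact_mod_cast this

theorem finite_cpState [Finite X] [Finite L] : Finite (CPState L M) := by
  classical
  obtain ⟨N, hN⟩ := exists_bound_maxConst M
  have := finite_regions M
  refine Finite.of_injective (β := L × {R : Set (Valuation X) // IsRegion M R} × (X → Fin (N + 1)))
    (fun s => (s.loc, ⟨s.region, s.isRegion⟩, fun x =>
      if h : x ∈ boundedClocks M s.region then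
        ⟨s.corner ⟨x, h⟩, Nat.lt_succ_of_le (s.corner_le h hN)⟩ else 0)) fun s s' h => ?_
  simp only [Prod.mk.injEq, Subtype.mk.injEq, funext_iff] at h
  refine CPState.ext_of_corner h.1 h.2.1 fun x hx hx' => ?_
  have := h.2.2 x
  rw [dif_pos hx, dif_pos hx'] at this
  exact congrArg Fin.val this

theorem boundedClocks_subset_of_timeSucc {R R' : Set (Valuation X)} (hR : IsRegion M R)
    (h : TimeSucc R R') : boundedClocks M R' ⊆ boundedClocks M R := by
  intro x hx v hv
  obtain ⟨-, u, hu, t, hut, -⟩ := h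
  obtain ⟨v₀, rfl⟩ := hR
  have h1 : LeBound (M x) (u x) := (hx _ hut).mono le_self_add
  exact (RegionEquiv.trans (RegionEquiv.symm hu) hv).1 x |>.1 h1

theorem WTA.exists_weight_bound [Finite L] (A : WTA X L) :
    ∃ B : ℕ, (∀ l, -(B : ℤ) ≤ A.locWeight l) ∧ ∀ e ∈ A.edges, -(B : ℤ) ≤ A.edgeWeight e := by
  obtain ⟨b₁, h₁⟩ := (Set.finite_range A.locWeight).bddBelow
  obtain ⟨b₂, h₂⟩ := (A.edges_finite.image A.edgeWeight).bddBelow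
  refine ⟨(max (-b₁) (-b₂)).toNat, fun l => ?_, fun e he => ?_⟩
  · have := h₁ ⟨l, rfl⟩
    omega
  · have := h₂ ⟨e, he, rfl⟩
    omega

end Finite

/-! ### Weights of frugal paths -/

section Weights

variable {X L : Type*} [DecidableEq X] {A : WTA X L} {M : X → WithBot ℕ}

/-- Corners act as a potential: bounded clocks are never gained by a delay, corners never decrease,
and a negative weight forces a strict increase. The nonempty set of bounded clocks makes this
increase contradict a return to the same state. -/
theorem FrugalStep.of_delay {s s' : CPState L M} {w : ℤ} (h : FrugalStep A M s .delay w s') :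
    boundedClocks M s'.region ⊆ boundedClocks M s.region ∧
      (∀ x h h', s.corner ⟨x, h⟩ ≤ s'.corner ⟨x, h'⟩) ∧
      (0 ≤ w ∨ ((boundedClocks M s.region).Nonempty ∧
        ∀ x h h', s.corner ⟨x, h⟩ < s'.corner ⟨x, h'⟩)) := by
  obtain ⟨h, hw⟩ := h
  cases h with
  | tick _ hl hR hne hα =>
    refine ⟨by rw [hR], fun x h h' => by rw [hα x h h']; exact Nat.le_succ _, ?_⟩
    right
    refine ⟨?_, fun x h h' => by rw [hα x h h']; exact Nat.lt_succ_self _⟩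
    -- Without bounded clocks a tick would not change the state, which `hne` excludes.
    by_contra hemp
    rw [Set.not_nonempty_iff_eq_empty] at hemp
    refine hne (CPState.ext_of_corner hl.symm hR.symm fun x hx _ => ?_)
    rw [hemp] at hx
    exact hx.elim
  | idle hR => exact ⟨subset_rfl, fun _ _ _ => le_rfl, .inl (hw rfl hR)⟩
  | cross _ hl hR hα =>
    exact ⟨boundedClocks_subset_of_timeSucc s.isRegion hR, fun x h h' => (hα x h h').ge,
      .inl le_rfl⟩

theorem FrugalPath.of_delay {s s' : CPState L M} {l : List (CPState L M)}
    {p : List (MoveKind × ℤ)} (h : FrugalPath A M s l p s') (hp : ∀ m ∈ p, m.1 = .delay) :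
    boundedClocks M s'.region ⊆ boundedClocks M s.region ∧
      (∀ x h h', s.corner ⟨x, h⟩ ≤ s'.corner ⟨x, h'⟩) ∧
      (0 ≤ (p.map Prod.snd).sum ∨ ((boundedClocks M s.region).Nonempty ∧
        ∀ x h h', s.corner ⟨x, h⟩ < s'.corner ⟨x, h'⟩)) := by
  induction h with
  | nil => exact ⟨subset_rfl, fun _ _ _ => le_rfl, .inl (by simp)⟩
  | @cons s s' s'' l k w p h _ ih =>
    obtain rfl : k = .delay := hp (k, w) (by simp)
    obtain ⟨h1, h2, h3⟩ := h.of_delay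
    obtain ⟨i1, i2, i3⟩ := ih fun m hm => hp m (List.mem_cons_of_mem _ hm)
    refine ⟨i1.trans h1, fun x hx hx' => (h2 x hx (i1 hx')).trans (i2 x _ hx'), ?_⟩
    rcases h3 with h3 | ⟨h3, h4⟩
    · rcases i3 with i3 | ⟨i3, i4⟩
      · left
        simpa using add_nonneg h3 i3
      · exact .inr ⟨i3.mono h1, fun x hx hx' => (h2 x hx (i1 hx')).trans_lt (i4 x _ hx')⟩
    · exact .inr ⟨h3, fun x hx hx' => (h4 x hx (i1 hx')).trans_le (i2 x _ hx')⟩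

theorem FrugalPath.toCPPath {s s' : CPState L M} {l : List (CPState L M)}
    {p : List (MoveKind × ℤ)} (h : FrugalPath A M s l p s') : CPPath A M s p s' := by
  induction h with
  | nil => exact .nil _
  | cons h _ ih => exact .cons h.1 ih

/-- A negative cycle with a discrete transition is excluded by assumption; one of delays only would
have to raise its corner strictly and yet return to it. -/
theorem FrugalPath.cycle_nonneg (hA : ¬ HasNegativeNonDelayCycle A M) {s : CPState L M}
    {l l' : List (CPState L M)} {p c : List (MoveKind × ℤ)}
    (hp : FrugalPath A M (CPState.initial A M) l' p s) (hc : FrugalPath A M s l c s) :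
    0 ≤ (c.map Prod.snd).sum := by
  by_contra! hneg
  by_cases hd : ∃ w, (MoveKind.discrete, w) ∈ c
  · exact hA ⟨s, p, c, hp.toCPPath, hc.toCPPath, hneg, hd⟩
  · have hall : ∀ m ∈ c, m.1 = .delay := by
      rintro ⟨k, w⟩ hm
      cases k with
      | delay => rfl
      | discrete => exact (hd ⟨w, hm⟩).elim
    obtain ⟨x, hx⟩ := ((hc.of_delay hall).2.2.resolve_left hneg.not_ge).1
    exact lt_irrefl _ (((hc.of_delay hall).2.2.resolve_left hneg.not_ge).2 x hx hx)

theorem FrugalPath.split {s s' a : CPState L M} {l : List (CPState L M)}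
    {p : List (MoveKind × ℤ)} (h : FrugalPath A M s l p s') (ha : a ∈ l) :
    ∃ l₁ l₂ p₁ p₂, l = l₁ ++ l₂ ∧ p = p₁ ++ p₂ ∧ FrugalPath A M s l₁ p₁ a ∧
      FrugalPath A M a l₂ p₂ s' := by
  induction h with
  | nil => simp at ha
  | @cons s s' s'' l k w p h hp ih =>
    rcases eq_or_ne a s with rfl | hne
    · exact ⟨[], _, [], _, rfl, rfl, .nil _, .cons h hp⟩
    · obtain ⟨l₁, l₂, p₁, p₂, rfl, rfl, h1, h2⟩ := ih ((List.mem_cons.1 ha).resolve_left hne)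
      exact ⟨s :: l₁, l₂, (k, w) :: p₁, p₂, rfl, rfl, .cons h h1, h2⟩

/-- Cycles of nonnegative weight can be removed. -/
theorem FrugalPath.exists_nodup (hA : ¬ HasNegativeNonDelayCycle A M) {s s' : CPState L M}
    {l : List (CPState L M)} {p : List (MoveKind × ℤ)} (h : FrugalPath A M s l p s')
    (hs : ∃ l₀ p₀, FrugalPath A M (CPState.initial A M) l₀ p₀ s) :
    ∃ l' p', FrugalPath A M s l' p' s' ∧ l'.Nodup ∧
      (p'.map Prod.snd).sum ≤ (p.map Prod.snd).sum := by
  induction h with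
  | nil => exact ⟨[], [], .nil _, List.nodup_nil, le_rfl⟩
  | @cons s s' s'' l k w p h hp ih =>
    obtain ⟨l₀, p₀, h₀⟩ := hs
    obtain ⟨l', p', hp', hnd, hle⟩ := ih ⟨_, _, h₀.append (.cons h (.nil _))⟩
    -- If the shortened tail returns to `s`, the new step and the tail up to this return form a
    -- reachable cycle; cutting it off does not increase the weight.
    by_cases hmem : s ∈ l'
    · obtain ⟨l₁, l₂, p₁, p₂, rfl, rfl, h1, h2⟩ := hp'.split hmem
      refine ⟨l₂, p₂, h2, hnd.of_append_right, ?_⟩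
      have := h₀.cycle_nonneg hA (.cons h h1)
      simp only [List.map_cons, List.map_append, List.sum_cons, List.sum_append] at this hle ⊢
      linarith
    · exact ⟨_, _, .cons h hp', List.nodup_cons.2 ⟨hmem, hnd⟩, by simpa using hle⟩

theorem FrugalPath.le_weight {B : ℕ} (hl : ∀ l, -(B : ℤ) ≤ A.locWeight l)
    (he : ∀ e ∈ A.edges, -(B : ℤ) ≤ A.edgeWeight e) {s s' : CPState L M}
    {l : List (CPState L M)} {p : List (MoveKind × ℤ)} (h : FrugalPath A M s l p s') :
    -((B * l.length : ℕ) : ℤ) ≤ (p.map Prod.snd).sum := by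
  induction h with
  | nil => simp
  | @cons s s' s'' l k w p h hp ih =>
    have hw : -(B : ℤ) ≤ w := by
      cases h.1 with
      | tick => exact hl _
      | idle => exact hl _
      | cross => simp
      | edge _ e hmem => exact he e hmem
    simp only [List.length_cons, List.map_cons, List.sum_cons, mul_add]
    push_cast at ih ⊢
    linarith

/-- Without negative cycles other than delays, the weights of frugal paths are bounded below. -/
theorem exists_frugalReach_bound [Finite X] [Finite L] (hA : ¬ HasNegativeNonDelayCycle A M) :
    ∃ K : ℕ, ∀ s c, FrugalReach A M (CPState.initial A M) s c → -(K : ℝ) ≤ c := by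
  obtain ⟨B, hl, he⟩ := A.exists_weight_bound
  have := finite_cpState (L := L) (M := M)
  have := Fintype.ofFinite (CPState L M)
  refine ⟨B * Fintype.card (CPState L M), fun s c ⟨l, p, hp, hc⟩ => ?_⟩
  obtain ⟨l', p', hp', hnd, hle⟩ := hp.exists_nodup hA ⟨[], [], .nil _⟩
  have h1 := hp'.le_weight hl he
  have h2 : B * l'.length ≤ B * Fintype.card (CPState L M) :=
    Nat.mul_le_mul_left _ hnd.length_le_card
  have h3 : -((B * Fintype.card (CPState L M) : ℕ) : ℤ) ≤ (p.map Prod.snd).sum := by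
    have : ((B * l'.length : ℕ) : ℤ) ≤ ((B * Fintype.card (CPState L M) : ℕ) : ℤ) := by
      exact_mod_cast h2
    linarith
  refine le_trans ?_ hc
  exact_mod_cast h3

end Weights

/-! ### Integrality of the minima -/

section Integrality

variable {X : Type*}

/-- The coefficients and the constant term are integers. -/
def CostFun.Integral (ζ : CostFun X) : Prop :=
  (∀ x, ∃ k : ℤ, ζ.coef x = k) ∧ ∃ k : ℤ, ζ.const = k

theorem integral_update [DecidableEq X] {c : X → ℝ} (hc : ∀ x, ∃ k : ℤ, c x = k) (y : X) {r : ℝ}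
    (hr : ∃ k : ℤ, r = k) (x : X) : ∃ k : ℤ, Function.update c y r x = k := by
  by_cases h : x = y
  · subst h; simpa using hr
  · simpa [h] using hc x

/-- Rounding preserves integral bounds on clocks and on differences, so the rounded point satisfies
the weak constraints, and mixing with a point of the zone places it in the closure. -/
theorem phaseRound_mem_closure_zone {Z : Set (Valuation X)} (hZ : IsZone Z) {v : Valuation X}
    (hv : v ∈ closure Z) (φ : ℝ) :
    (fun x => ((phaseRound φ (v x)).toNat : ℝ≥0)) ∈ closure Z := by
  obtain ⟨l, rfl⟩ := hZ
  obtain ⟨z, hz⟩ := closure_nonempty_iff.1 ⟨v, hv⟩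
  refine mem_closure_of_mix (z := z) fun a b hab hb => mix_mem_zone (fun c hc => ?_) hz hab hb
  have hw := c.weakHolds_of_mem_closure (Z := {v | ∀ c ∈ l, c.Sat v}) (fun v hv => hv c hc) hv
  have hr := fun x => coe_toNat_phaseRound φ (v x)
  have hle : ∀ k : ℤ, c.lhs v ≤ k → c.lhs (fun x => ((phaseRound φ (v x)).toNat : ℝ≥0)) ≤ k := by
    intro k hk
    cases c with
    | clock x r n =>
      simp only [ZoneAtom.lhs, hr] at hk ⊢
      exact_mod_cast phaseRound_le hk
    | diff x y r n =>
      simp only [ZoneAtom.lhs, hr] at hk ⊢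
      exact_mod_cast phaseRound_sub_le (φ := φ) hk
  have hge : ∀ k : ℤ, (k : ℝ) ≤ c.lhs v →
      (k : ℝ) ≤ c.lhs (fun x => ((phaseRound φ (v x)).toNat : ℝ≥0)) := by
    intro k hk
    cases c with
    | clock x r n =>
      simp only [ZoneAtom.lhs, hr] at hk ⊢
      exact_mod_cast le_phaseRound hk
    | diff x y r n =>
      simp only [ZoneAtom.lhs, hr] at hk ⊢
      have h1 := phaseRound_sub_le (φ := φ) (a := v y) (b := v x) (c := -k) (by
        push_cast; linarith)
      have h2 : k ≤ phaseRound φ (v x) - phaseRound φ (v y) := by linarith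
      exact_mod_cast h2
  cases hrel : c.rel <;> rw [hrel] at hw <;> simp only [Cmp.WeakHolds] at hw ⊢
  · exact hle _ hw
  · exact hle _ hw
  · exact le_antisymm (hle _ hw.le) (hge _ hw.ge)
  · exact hge _ hw
  · exact hge _ hw

theorem CostFun.Integral.substConst [DecidableEq X] {ζ : CostFun X} (h : ζ.Integral) (y : X) (n : ℤ) :
    (ζ.substConst y n).Integral := by
  obtain ⟨k, hk⟩ := h.1 y
  obtain ⟨c, hc⟩ := h.2
  exact ⟨integral_update h.1 y ⟨0, by simp⟩, c + k * n, by simp [CostFun.substConst, hc, hk]⟩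

theorem CostFun.Integral.substClock [DecidableEq X] {ζ : CostFun X} (h : ζ.Integral) (y x : X) (m : ℤ) :
    (ζ.substClock y x m).Integral := by
  obtain ⟨k, hk⟩ := h.1 y
  obtain ⟨k', hk'⟩ := h.1 x
  obtain ⟨c, hc⟩ := h.2
  exact ⟨integral_update (integral_update h.1 x ⟨k' + k, by rw [hk, hk']; push_cast; ring⟩) y
    ⟨0, by simp⟩, c + k * m, by simp [CostFun.substClock, hc, hk]⟩

theorem ResetPost.integral [DecidableEq X] {y : X} {P P' : PricedZone X} (h : ResetPost y P P')
    (hP : P.cost.Integral) : P'.cost.Integral := by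
  cases h with
  | lowerClock n _ _ _ hc => rw [hc]; exact hP.substConst y n
  | lowerDiff x m _ _ _ _ hc => rw [hc]; exact hP.substClock y x m
  | upperClock n _ _ _ hc => rw [hc]; exact hP.substConst y n
  | upperDiff x m _ _ _ _ hc => rw [hc]; exact hP.substClock y x m

theorem ResetListPost.integral [DecidableEq X] {l : List X} {P P' : PricedZone X} (h : ResetListPost l P P')
    (hP : P.cost.Integral) : P'.cost.Integral := by
  induction l generalizing P with
  | nil =>
    obtain rfl : P' = P := h
    exact hP
  | cons y l ih =>
    obtain ⟨Q, hQ, hl⟩ := h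
    exact ih hl (hQ.integral hP)

variable [Fintype X]

theorem CostFun.Integral.eval_natCast {ζ : CostFun X} (h : ζ.Integral) (u : X → ℕ) :
    ∃ k : ℤ, ζ.eval (fun x => (u x : ℝ≥0)) = k := by
  obtain ⟨h, c, hc⟩ := h
  choose k hk using h
  exact ⟨∑ x, k x * u x + c, by simp [CostFun.eval, hk, hc]⟩

theorem CostFun.Integral.slope {ζ : CostFun X} (h : ζ.Integral) : ∃ k : ℤ, ζ.slope = k := by
  choose k hk using h.1
  exact ⟨∑ x, k x, by simp [CostFun.slope, hk]⟩

/-- Some rounding of a point does not increase the value of an affine function. -/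
theorem CostFun.exists_phaseRound_le (ζ : CostFun X) (v : Valuation X) :
    ∃ φ, ζ.eval (fun x => ((phaseRound φ (v x)).toNat : ℝ≥0)) ≤ ζ.eval v := by
  have hi : ∀ x ∈ Finset.univ, IntervalIntegrable (fun φ => ζ.coef x * phaseRound φ (v x))
      MeasureTheory.volume 0 1 := fun x _ => (intervalIntegrable_phaseRound _ 0 1).const_mul _
  have hs := IntervalIntegrable.sum Finset.univ hi
  have hI : IntervalIntegrable (fun φ => ∑ x, ζ.coef x * phaseRound φ (v x) + ζ.const)
      MeasureTheory.volume 0 1 := by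
    have := hs.add (intervalIntegrable_const (c := ζ.const))
    simpa [Finset.sum_fn, Pi.add_def] using this
  -- By linearity the cost of the rounding, averaged over the phase, is the cost of `v`; some phase
  -- does not exceed the average.
  obtain ⟨φ, hφ⟩ := exists_le_of_integral_le (c := ζ.eval v) hI (by
    rw [intervalIntegral.integral_add (by simpa [Finset.sum_fn] using hs) intervalIntegrable_const,
      intervalIntegral.integral_finsetSum hi]
    simp_rw [intervalIntegral.integral_const_mul, integral_phaseRound]
    simp [CostFun.eval])
  refine ⟨φ, le_trans (le_of_eq ?_) hφ⟩
  unfold CostFun.eval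
  congr 1
  refine Finset.sum_congr rfl fun x _ => ?_
  rw [coe_toNat_phaseRound]

theorem isZone_restrictTo {Z : Set (Valuation X)} (hZ : IsZone Z) (M : X → WithBot ℕ) (Y : Set X) :
    IsZone (restrictTo M Y Z) := by
  classical
  obtain ⟨l, rfl⟩ := hZ
  have hatom : ∀ x, ∃ lx : List (ZoneAtom X), ∀ v : Valuation X,
      (∀ c ∈ lx, c.Sat v) ↔ (x ∈ Y ↔ LeBound (M x) (v x)) := by
    intro x
    cases hM : M x with
    | bot =>
      have hb : ∀ v : Valuation X, ¬ LeBound ⊥ (v x) := fun v => by simp [LeBound]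
      by_cases hx : x ∈ Y
      -- No clock is at most `-∞`, so for `x ∈ Y` the condition is unsatisfiable; `x < 0` encodes
      -- falsity.
      · exact ⟨[.clock x .lt 0], fun v => by
          simp [ZoneAtom.Sat, Cmp.Holds, hx, hb]⟩
      · exact ⟨[], fun v => by simp [hx, hb]⟩
    | coe k =>
      have hb : ∀ v : Valuation X, LeBound (WithBot.some k) (v x) ↔ (v x : ℝ) ≤ k := fun v => by
        constructor
        · rintro ⟨k', hk, hv⟩
          obtain rfl : k = k' := WithBot.coe_injective hk
          exact_mod_cast hv
        · exact fun h => ⟨k, rfl, by exact_mod_cast h⟩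
      by_cases hx : x ∈ Y
      · exact ⟨[.clock x .le k], fun v => by
          simpa [ZoneAtom.Sat, Cmp.Holds, hx] using (hb v).symm⟩
      · exact ⟨[.clock x .gt k], fun v => by
          simpa [ZoneAtom.Sat, Cmp.Holds, hx] using (not_congr (hb v)).symm⟩
  choose f hf using hatom
  refine ⟨l ++ Finset.univ.toList.flatMap f, ?_⟩
  ext v
  have : (∀ c ∈ l ++ Finset.univ.toList.flatMap f, c.Sat v) ↔
      (∀ c ∈ l, c.Sat v) ∧ ∀ x, ∀ c ∈ f x, c.Sat v := by
    simp only [List.mem_append, List.mem_flatMap, Finset.mem_toList, Finset.mem_univ, true_and]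
    exact ⟨fun h => ⟨fun c hc => h c (.inl hc), fun x c hc => h c (.inr ⟨x, hc⟩)⟩,
      fun h c hc => hc.elim (h.1 c) fun ⟨x, hx⟩ => h.2 x c hx⟩
  rw [mem_ofPred_eq, this]
  simp only [hf]
  exact Iff.rfl

/-- The minima of the cost on the points over an integral point are integers or `+∞`. -/
theorem kappa_eq_top_or_intCast {M : X → WithBot ℕ} {Y : Set X} {P : PricedZone X}
    (hP : P.cost.Integral) {K : ℝ} (hK : ∀ v ∈ closure P.zone, K ≤ P.cost.eval v)
    (u : GridPoint M Y) :
    kappa M Y P u = ⊤ ∨ ∃ k : ℤ, K ≤ k ∧ kappa M Y P u = ((k : ℝ) : EReal) := by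
  set S : Set (Valuation X) :=
    {v ∈ closure (restrictTo M Y P.zone) | ∀ y : Y, v y = (u.1 y : ℝ≥0)} with hS
  have hk : kappa M Y P u = ⨅ v ∈ S, ((P.cost.eval v : ℝ) : EReal) := rfl
  rcases S.eq_empty_or_nonempty with he | ⟨v₀, hv₀⟩
  · left
    rw [hk, he]
    simp
  right
  have hSK : ∀ v ∈ S, K ≤ P.cost.eval v := fun v hv =>
    hK v (closure_mono (sep_subset _ _) hv.1)
  -- Rounding fixes the clocks that are already integral, so the rounded point still projects to
  -- `u`; its cost is an integer. The minimum may therefore be sought among integers.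
  have hround : ∀ v ∈ S, ∃ w ∈ S, P.cost.eval w ≤ P.cost.eval v ∧ ∃ k : ℤ, P.cost.eval w = k := by
    rintro v ⟨hv, hvu⟩
    obtain ⟨φ, hφ⟩ := P.cost.exists_phaseRound_le v
    refine ⟨_, ⟨phaseRound_mem_closure_zone (isZone_restrictTo P.isZone M Y) hv φ, fun y => ?_⟩,
      hφ, hP.eval_natCast fun x => (phaseRound φ (v x)).toNat⟩
    have := phaseRound_intCast φ (u.1 y)
    rw [hvu y]
    push_cast at this
    simp [this]
  let T : Set ℤ := {k | ∃ w ∈ S, P.cost.eval w = k}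
  have hT : T.Nonempty := by
    obtain ⟨w, hw, -, k, hk⟩ := hround v₀ hv₀
    exact ⟨k, w, hw, hk⟩
  have hTb : BddBelow T := by
    refine ⟨⌊K⌋, ?_⟩
    rintro k ⟨w, hw, hk⟩
    have := hSK w hw
    rw [hk] at this
    have h2 : (⌊K⌋ : ℝ) ≤ k := (Int.floor_le K).trans this
    exact_mod_cast h2
  obtain ⟨w, hw, hwk⟩ := Int.csInf_mem hT hTb
  refine ⟨sInf T, hwk ▸ hSK w hw, ?_⟩
  rw [hk]
  apply le_antisymm
  · rw [← hwk]
    exact iInf₂_le w hw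
  · refine le_iInf₂ fun v hv => ?_
    obtain ⟨w', hw', hle, k, hk'⟩ := hround v hv
    have h1 : sInf T ≤ k := csInf_le hTb ⟨w', hw', hk'⟩
    have h2 : ((sInf T : ℤ) : ℝ) ≤ k := by exact_mod_cast h1
    exact EReal.coe_le_coe_iff.2 (h2.trans (hk' ▸ hle))

variable [DecidableEq X]

theorem CostFun.Integral.afterDelay {ζ : CostFun X} (h : ζ.Integral) (w : ℤ) (x : X) (n : ℤ) :
    (ζ.afterDelay w x n).Integral := by
  obtain ⟨s, hs⟩ := h.slope
  obtain ⟨k, hk⟩ := h.1 x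
  obtain ⟨c, hc⟩ := h.2
  exact ⟨integral_update h.1 x ⟨k + (w - s), by rw [hk, hs]; push_cast; ring⟩,
    c - n * (w - s), by simp [CostFun.afterDelay, hc, hs]⟩

theorem DelayPost.integral {w : ℤ} {P P' : PricedZone X} (h : DelayPost w P P')
    (hP : P.cost.Integral) : P'.cost.Integral := by
  cases h with
  | stay _ h => rwa [h]
  | upper x n _ _ _ hc => rw [hc]; exact hP.afterDelay w x n
  | lower x n _ _ _ hc => rw [hc]; exact hP.afterDelay w x n

theorem Explored.integral {L : Type*} {A : WTA X L} {s : L × PricedZone X} (h : Explored A s) :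
    s.2.cost.Integral := by
  have key : ∀ s : L × PricedZone X,
      Relation.ReflTransGen (Post A) (A.init, PricedZone.initial X) s → s.2.cost.Integral := by
    intro s hs
    induction hs with
    | refl => exact ⟨fun _ => ⟨0, by simp [PricedZone.initial]⟩, 0, by simp [PricedZone.initial]⟩
    | tail _ hp ih =>
      obtain ⟨e, -, -, -, Q, hd, Q', R, l, -, hQ, -, -, hR, -, hc⟩ := hp
      have h1 := hR.integral (by rw [hQ]; exact hd.integral ih)
      obtain ⟨k, hk⟩ := h1.2
      rw [hc]
      exact ⟨h1.1, k + A.edgeWeight e, by simp [CostFun.addConst, hk]⟩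
  obtain ⟨s₀, h₀, rfl | ⟨-, hd⟩⟩ := h
  · exact key _ h₀
  · exact hd.integral (key _ h₀)

end Integrality

/-! ### Finitely many grid points and the well-quasi-order on tuples -/

theorem finite_gridPoint {X : Type*} [Finite X] (M : X → WithBot ℕ) (Y : Set X) :
    Finite (GridPoint M Y) := by
  obtain ⟨N, hN⟩ := exists_bound_maxConst M
  refine Finite.of_injective (β := Y → Fin (N + 1)) (fun u y => ⟨u.1 y, Nat.lt_succ_of_le ?_⟩) ?_
  · have h := u.2 y
    cases hM : M y with
    | bot => simp [hM] at h
    | coe k =>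
      rw [hM] at h
      exact (WithBot.coe_le_coe.1 h : u.1 y ≤ k).trans (hN _ _ hM)
  · intro u u' h
    refine Subtype.ext (funext fun y => ?_)
    exact congrArg Fin.val (congrFun h y)

/-- A sequence of tuples of integers and `+∞` that is bounded from below is not an antichain. -/
theorem exists_ne_le_of_bddBelow {ι : Type*} [Finite ι] (f : ℕ → ι → EReal) (K : ℤ)
    (hf : ∀ i u, f i u = ⊤ ∨ ∃ k : ℤ, K ≤ k ∧ f i u = ((k : ℝ) : EReal)) :
    ∃ i j, i ≠ j ∧ f i ≤ f j := by
  have hg : ∀ i u, ∃ m : ℕ∞, (m = ⊤ ∧ f i u = ⊤) ∨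
      ∃ n : ℕ, m = n ∧ f i u = (((K + n : ℤ) : ℝ) : EReal) := by
    intro i u
    rcases hf i u with h | ⟨k, hk, h⟩
    · exact ⟨⊤, .inl ⟨rfl, h⟩⟩
    · obtain ⟨n, rfl⟩ := Int.le.dest hk
      exact ⟨n, .inr ⟨n, rfl, h⟩⟩
  choose g hg using hg
  obtain ⟨i, j, hij, hle⟩ := wellQuasiOrdered_le (α := ι → ℕ∞) g
  refine ⟨i, j, hij.ne, fun u => ?_⟩
  have hu := hle u
  rcases hg j u with ⟨-, hj⟩ | ⟨n, hn, hj⟩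
  · rw [hj]; exact le_top
  · rcases hg i u with ⟨hi, -⟩ | ⟨m, hm, hi⟩
    · rw [hi, hn] at hu
      exact absurd hu (by simp)
    · rw [hi, hj]
      rw [hm, hn] at hu
      have : m ≤ n := Nat.cast_le.1 hu
      have h2 : ((K + m : ℤ) : ℝ) ≤ ((K + n : ℤ) : ℝ) := by
        have : K + (m : ℤ) ≤ K + n := by omega
        exact_mod_cast this
      exact EReal.coe_le_coe_iff.2 h2

end PTA

theorem mainTheorem11 {X L : Type*} [Fintype X] [DecidableEq X] [Finite L]
    (A : PTA.WTA X L) (M : X → WithBot ℕ) (hM : PTA.IsMaxConst A M)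
    (l : L) (Z : ℕ → PTA.PricedZone X)
    (hexp : ∀ i, PTA.Explored A (l, Z i))
    (hlb : ∀ i, (Z i).LowerBounded)
    (Y : Set X)
    (hproj : ∀ i, PTA.proj Y '' PTA.restrictTo M Y (Z (i + 1)).zone ⊆
      PTA.proj Y '' PTA.restrictTo M Y (Z i).zone)
    (hanti : ∀ i j, i ≠ j → ¬ PTA.kappa M Y (Z i) ≤ PTA.kappa M Y (Z j)) :
    PTA.HasNegativeNonDelayCycle A M := by
  by_contra hA
  obtain ⟨K, hK⟩ := PTA.exists_frugalReach_bound hA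
  -- The summand `-1` compensates the approximation error in `Explored.exists_frugalReach`. The
  -- bound does not depend on `i`.
  have hcost : ∀ i, ∀ v ∈ closure (Z i).zone, ((-K - 1 : ℤ) : ℝ) ≤ (Z i).cost.eval v := by
    intro i v hv
    obtain ⟨s, hs⟩ := (hexp i).exists_frugalReach hM (hlb i) hv
    have := hK s _ hs
    push_cast
    linarith
  have := PTA.finite_gridPoint M Y
  obtain ⟨i, j, hij, hle⟩ := PTA.exists_ne_le_of_bddBelow (fun i => PTA.kappa M Y (Z i))
    (-K - 1) fun i u => by
      rcases PTA.kappa_eq_top_or_intCast (hexp i).integral (hcost i) u with h | ⟨k, hk, h⟩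
      · exact .inl h
      · exact .inr ⟨k, by exact_mod_cast hk, h⟩
  exact hanti i j hij hle
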